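/- Let $\Bbbk$ be a field of characteristic zero. Let $\mathrm{PL}$ be the operad of (right) pre-Lie algebras, presented as $\mathcal T(\mathcal X)/(\mathcal R)$, where $\mathcal X$ is spanned by one binary operation $a_1\triangleleft a_2$ without symmetries and its opposite, and $\mathcal R$ is spanned by the relations $(a_1\triangleleft a_2)\triangleleft a_3-a_1\triangleleft(a_2\triangleleft a_3)=(a_1\triangleleft a_3)\triangleleft a_2-a_1\triangleleft(a_3\triangleleft a_2)$ and their permutations. Let $\mathrm{Com}$ be the operad of (non-unital) commutative associative algebras, and let $f\colon\mathrm{PL}\to\mathrm{Com}$ be the projection that sends $a_1\triangleleft a_2$ to $a_1\cdot a_2$. Let $\mathrm{PL}^{¡}$ be the Koszul dual cooperad of $\mathrm{PL}$, that is the largest subcooperad of the cofree conilpotent cooperad $\mathcal T^c(s\mathcal X)$ whose component of weight two is contained in $s^2\mathcal R$. The deformation complex of $f$ is the complex (homologically graded, with differential of degree $-1$) $$\mathrm{Def}(f)=\Bigl(\prod_{n\ge1}\mathrm{Hom}\bigl(\mathrm{PL}^{¡}(n),\mathrm{Com}(n)\bigr)^{\mathbb S_n},\ d_\alpha=[\alpha,-]\Bigr).$$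 Here $[\phi,\psi]=\phi\triangleleft\psi-(-1)^{|\phi||\psi|}\psi\triangleleft\phi$ is the Lie bracket of the convolution pre-Lie product $\phi\triangleleft\psi$, the composite of the infinitesimal decomposition of $\mathrm{PL}^{¡}$, of $\phi\otimes\psi$, and of the partial compositions of $\mathrm{Com}$; and $\alpha$ is the Maurer–Cartan element of degree $-1$ that sends $s(a_1\triangleleft a_2)$ to $a_1\cdot a_2$ and vanishes on $\mathrm{PL}^{¡}(n)$ for $n\neq2$. The counit is not removed from $\mathrm{PL}^{¡}$, so the component $n=1$ is included. **Theorem.** The complex $\mathrm{Def}(f\colon\mathrm{PL}\to\mathrm{Com})$ is acyclic. Moreover, it is concentrated in degrees $0$ and $-1$; its component of degree $0$ is one-dimensional, and the differential is an isomorphism from the component of degree $0$ to the component of degree $-1$. -/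

import Mathlib

open scoped TensorProduct

universe u

namespace PreLieDef

section Relabelling

/-- `A ⊔ (B ⊔ {*}) ≃ (A ⊔ B) ⊔ {*}`. -/
def sumOption (A B : Type) : A ⊕ Option B ≃ Option (A ⊕ B) where
  toFun
    | .inl a => some (.inl a)
    | .inr none => none
    | .inr (some b) => some (.inr b)
  invFun
    | none => .inr none
    | some (.inl a) => .inl a
    | some (.inr b) => .inr (some b)
  left_inv := by rintro (a | _ | b) <;> rfl
  right_inv := by rintro (_ | a | b) <;> rfl

/-- `(A ⊔ {*}) ⊔ B ≃ (A ⊔ B) ⊔ {*}`. -/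
def optionSum (A B : Type) : Option A ⊕ B ≃ Option (A ⊕ B) where
  toFun
    | .inl none => none
    | .inl (some a) => some (.inl a)
    | .inr b => some (.inr b)
  invFun
    | none => .inl none
    | some (.inl a) => .inl (some a)
    | some (.inr b) => .inr b
  left_inv := by rintro ((_ | a) | b) <;> rfl
  right_inv := by rintro (_ | a | b) <;> rfl

/-- The transposition of the two marked points of `(A ⊔ {*}) ⊔ {*'}`. -/
def optionSwap (A : Type) : Option (Option A) ≃ Option (Option A) where
  toFun
    | none => some none
    | some none => none
    | some (some a) => some (some a)
  invFun
    | none => some none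
    | some none => none
    | some (some a) => some (some a)
  left_inv := by rintro (_ | _ | a) <;> rfl
  right_inv := by rintro (_ | _ | a) <;> rfl

/-- `(A ⊔ B) ⊔ C ≃ (A ⊔ C) ⊔ B`. -/
def sumSwap (A B C : Type) : (A ⊕ B) ⊕ C ≃ (A ⊕ C) ⊕ B where
  toFun
    | .inl (.inl a) => .inl (.inl a)
    | .inl (.inr b) => .inr b
    | .inr c => .inl (.inr c)
  invFun
    | .inl (.inl a) => .inl (.inl a)
    | .inl (.inr c) => .inr c
    | .inr b => .inl (.inr b)
  left_inv := by rintro ((a | b) | c) <;> rfl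
  right_inv := by rintro ((a | c) | b) <;> rfl

/-- `I ≃ (I ∖ J) ⊔ J`. -/
noncomputable def splitEquiv {I : Type} (J : Set I) : I ≃ {i // i ∉ J} ⊕ {i // i ∈ J} :=
  open Classical in
  ((Equiv.sumComm _ _).trans (Equiv.sumCompl (fun i => i ∈ J))).symm

end Relabelling

/-! ### Symmetric operads -/

/-- A symmetric operad in `k`-vector spaces (placed in homological degree `0`), in its partial
form: a functor `I ↦ P(I)` from finite sets and bijections to vector spaces (an `𝕊`-module), a
unit in arity one, and the partial compositions `P(A ⊔ {*}) ⊗ P(B) → P(A ⊔ B)`, `a ⊗ b ↦ a ∘_* b`,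
which are equivariant, unital, and satisfy the sequential and the parallel associativity axioms. -/
structure Operad (k : Type u) [Field k] where
  obj : (I : Type) → [Finite I] → Type u
  [addCommGroup : ∀ (I : Type) [Finite I], AddCommGroup (obj I)]
  [module : ∀ (I : Type) [Finite I], Module k (obj I)]
  map : ∀ {I J : Type} [Finite I] [Finite J], (I ≃ J) → obj I →ₗ[k] obj J
  map_refl : ∀ {I : Type} [Finite I] (x : obj I), map (Equiv.refl I) x = x
  map_trans : ∀ {I J K : Type} [Finite I] [Finite J] [Finite K] (e : I ≃ J) (e' : J ≃ K)
    (x : obj I), map (e.trans e') x = map e' (map e x)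
  one : obj Unit
  comp : ∀ {A B : Type} [Finite A] [Finite B],
    obj (Option A) →ₗ[k] obj B →ₗ[k] obj (A ⊕ B)
  comp_map : ∀ {A A' B B' : Type} [Finite A] [Finite A'] [Finite B] [Finite B']
    (σ : A ≃ A') (τ : B ≃ B') (a : obj (Option A)) (b : obj B),
    comp (map (Equiv.optionCongr σ) a) (map τ b) = map (Equiv.sumCongr σ τ) (comp a b)
  comp_one : ∀ {A : Type} [Finite A] (a : obj (Option A)),
    comp a one = map (Equiv.optionEquivSumPUnit A) a
  one_comp : ∀ {B : Type} [Finite B] (b : obj B),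
    comp (map (Equiv.ofUnique Unit (Option Empty)) one) b = map (Equiv.emptySum Empty B).symm b
  assoc_seq : ∀ {A B C : Type} [Finite A] [Finite B] [Finite C]
    (a : obj (Option A)) (b : obj (Option B)) (c : obj C),
    map (Equiv.sumAssoc A B C) (comp (map (sumOption A B) (comp a b)) c) = comp a (comp b c)
  assoc_par : ∀ {A B C : Type} [Finite A] [Finite B] [Finite C]
    (a : obj (Option (Option A))) (b : obj B) (c : obj C),
    map (sumSwap A B C) (comp (map (optionSum A B) (comp a b)) c) =
      comp (map (optionSum A C) (comp (map (optionSwap A) a) c)) b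

attribute [instance] Operad.addCommGroup Operad.module

namespace Operad

variable {k : Type u} [Field k]

/-- Morphisms of operads. -/
structure Hom (P Q : Operad k) where
  app : ∀ (I : Type) [Finite I], P.obj I →ₗ[k] Q.obj I
  app_map : ∀ {I J : Type} [Finite I] [Finite J] (e : I ≃ J) (x : P.obj I),
    app J (P.map e x) = Q.map e (app I x)
  app_one : app Unit P.one = Q.one
  app_comp : ∀ {A B : Type} [Finite A] [Finite B] (a : P.obj (Option A)) (b : P.obj B),
    app (A ⊕ B) (P.comp a b) = Q.comp (app (Option A) a) (app B b)

/-- Operadic ideals. -/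
structure Ideal (P : Operad k) where
  carrier : ∀ (I : Type) [Finite I], Submodule k (P.obj I)
  map_mem : ∀ {I J : Type} [Finite I] [Finite J] (e : I ≃ J) (x : P.obj I),
    x ∈ carrier I → P.map e x ∈ carrier J
  comp_mem_left : ∀ {A B : Type} [Finite A] [Finite B] (a : P.obj (Option A)) (b : P.obj B),
    a ∈ carrier (Option A) → P.comp a b ∈ carrier (A ⊕ B)
  comp_mem_right : ∀ {A B : Type} [Finite A] [Finite B] (a : P.obj (Option A)) (b : P.obj B),
    b ∈ carrier B → P.comp a b ∈ carrier (A ⊕ B)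

/-- The ideal generated by a set of elements of `P(I₀)`: the smallest ideal containing it. -/
def Ideal.span (P : Operad k) (I₀ : Type) [Finite I₀] (S : Set (P.obj I₀)) : Ideal P where
  carrier I _ := ⨅ N : {N : Ideal P // S ⊆ N.carrier I₀}, N.1.carrier I
  map_mem e x hx := by
    simp only [Submodule.mem_iInf] at hx ⊢
    exact fun N => N.1.map_mem e x (hx N)
  comp_mem_left a b h := by
    simp only [Submodule.mem_iInf] at h ⊢
    exact fun N => N.1.comp_mem_left a b (h N)
  comp_mem_right a b h := by
    simp only [Submodule.mem_iInf] at h ⊢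
    exact fun N => N.1.comp_mem_right a b (h N)

/-- The kernel of a morphism of operads. -/
def Hom.ker {P Q : Operad k} (f : Hom P Q) : Ideal P where
  carrier I _ := LinearMap.ker (f.app I)
  map_mem e x hx := by
    simp only [LinearMap.mem_ker] at hx ⊢
    rw [f.app_map, hx, _root_.map_zero]
  comp_mem_left a b h := by
    simp only [LinearMap.mem_ker] at h ⊢
    rw [f.app_comp, h, _root_.map_zero, LinearMap.zero_apply]
  comp_mem_right a b h := by
    simp only [LinearMap.mem_ker] at h ⊢
    rw [f.app_comp, h, _root_.map_zero]

/-- The partial composition of a quotient operad. -/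
def quotientComp (P : Operad k) (N : Ideal P) (A B : Type) [Finite A] [Finite B] :
    (P.obj (Option A) ⧸ N.carrier (Option A)) →ₗ[k] (P.obj B ⧸ N.carrier B) →ₗ[k]
      (P.obj (A ⊕ B) ⧸ N.carrier (A ⊕ B)) :=
  (N.carrier (Option A)).liftQ
    (((N.carrier B).liftQ
      (((P.comp (A := A) (B := B)).compr₂ (N.carrier (A ⊕ B)).mkQ).flip)
      (fun b hb => LinearMap.ext fun a =>
        (Submodule.Quotient.mk_eq_zero _).mpr (N.comp_mem_right a b hb))).flip)
    (fun a ha => LinearMap.ext fun b => by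
      obtain ⟨b, rfl⟩ := Submodule.mkQ_surjective _ b
      exact (Submodule.Quotient.mk_eq_zero _).mpr (N.comp_mem_left a b ha))

/-- The quotient of an operad by an ideal. -/
def quotient (P : Operad k) (N : Ideal P) : Operad k where
  obj I _ := P.obj I ⧸ N.carrier I
  map {I J} _ _ e := (N.carrier I).mapQ (N.carrier J) (P.map e) (fun x hx => N.map_mem e x hx)
  map_refl {I} _ x := by
    obtain ⟨x, rfl⟩ := Submodule.mkQ_surjective _ x
    exact congrArg (N.carrier I).mkQ (P.map_refl x)
  map_trans {I J K} _ _ _ e e' x := by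
    obtain ⟨x, rfl⟩ := Submodule.mkQ_surjective _ x
    exact congrArg (N.carrier K).mkQ (P.map_trans e e' x)
  one := (N.carrier Unit).mkQ P.one
  comp {A B} _ _ := quotientComp P N A B
  comp_map {A A' B B'} _ _ _ _ σ τ a b := by
    obtain ⟨a, rfl⟩ := Submodule.mkQ_surjective _ a
    obtain ⟨b, rfl⟩ := Submodule.mkQ_surjective _ b
    exact congrArg (N.carrier (A' ⊕ B')).mkQ (P.comp_map σ τ a b)
  comp_one {A} _ a := by
    obtain ⟨a, rfl⟩ := Submodule.mkQ_surjective _ a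
    exact congrArg (N.carrier (A ⊕ Unit)).mkQ (P.comp_one a)
  one_comp {B} _ b := by
    obtain ⟨b, rfl⟩ := Submodule.mkQ_surjective _ b
    exact congrArg (N.carrier (Empty ⊕ B)).mkQ (P.one_comp b)
  assoc_seq {A B C} _ _ _ a b c := by
    obtain ⟨a, rfl⟩ := Submodule.mkQ_surjective _ a
    obtain ⟨b, rfl⟩ := Submodule.mkQ_surjective _ b
    obtain ⟨c, rfl⟩ := Submodule.mkQ_surjective _ c
    exact congrArg (N.carrier (A ⊕ (B ⊕ C))).mkQ (P.assoc_seq a b c)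
  assoc_par {A B C} _ _ _ a b c := by
    obtain ⟨a, rfl⟩ := Submodule.mkQ_surjective _ a
    obtain ⟨b, rfl⟩ := Submodule.mkQ_surjective _ b
    obtain ⟨c, rfl⟩ := Submodule.mkQ_surjective _ c
    exact congrArg (N.carrier ((A ⊕ C) ⊕ B)).mkQ (P.assoc_par a b c)

/-- The projection onto a quotient operad. -/
def quotientMk (P : Operad k) (N : Ideal P) : Hom P (P.quotient N) where
  app I _ := (N.carrier I).mkQ
  app_map _ _ := rfl
  app_one := rfl
  app_comp _ _ := rfl

/-- The morphism from a quotient operad induced by a morphism that kills the ideal. -/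
def quotientLift {P Q : Operad k} (N : Ideal P) (f : Hom P Q)
    (hf : ∀ (I : Type) [Finite I], N.carrier I ≤ LinearMap.ker (f.app I)) :
    Hom (P.quotient N) Q where
  app I _ := (N.carrier I).liftQ (f.app I) (hf I)
  app_map e x := by
    obtain ⟨x, rfl⟩ := Submodule.mkQ_surjective _ x
    exact f.app_map e x
  app_one := f.app_one
  app_comp a b := by
    obtain ⟨a, rfl⟩ := Submodule.mkQ_surjective _ a
    obtain ⟨b, rfl⟩ := Submodule.mkQ_surjective _ b
    exact f.app_comp a b

end Operad

/-- The operad `Com` of (non-unital) commutative associative algebras: `Com(I)` is the trivial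
one-dimensional representation `k` for `I ≠ ∅`, and `Com(∅) = 0`; all compositions are given by
the multiplication of `k`. -/
def Com (k : Type u) [Field k] : Operad k where
  obj I _ := ({ carrier := {x | IsEmpty I → x = 0}
                add_mem' := fun {x y} hx hy h => by rw [hx h, hy h, add_zero]
                zero_mem' := fun _ => rfl
                smul_mem' := fun c x hx h => by rw [hx h, smul_zero] } : Submodule k k)
  map e := LinearMap.codRestrict _ (Submodule.subtype _)
    (fun x h => x.2 (e.isEmpty_congr.mpr h))
  map_refl x := rfl
  map_trans e e' x := rfl
  one := ⟨1, fun h => (h.false ()).elim⟩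
  comp {A B} _ _ := LinearMap.mk₂ k
    (fun a b => ⟨a.1 * b.1, fun h => by rw [b.2 (isEmpty_sum.mp h).2, mul_zero]⟩)
    (fun a a' b => Subtype.ext (add_mul _ _ _))
    (fun c a b => Subtype.ext (mul_assoc _ _ _))
    (fun a b b' => Subtype.ext (mul_add _ _ _))
    (fun c a b => Subtype.ext (mul_left_comm _ _ _))
  comp_map σ τ a b := rfl
  comp_one a := Subtype.ext (mul_one _)
  one_comp b := Subtype.ext (one_mul _)
  assoc_seq a b c := Subtype.ext (mul_assoc _ _ _)
  assoc_par a b c := Subtype.ext (mul_right_comm _ _ _)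

/-! ### Trees -/

/-- Planar binary rooted trees with leaves labelled by `I`. -/
inductive PTree (I : Type) : Type
  | leaf (i : I) : PTree I
  | node (l r : PTree I) : PTree I

namespace PTree

variable {I J K A B : Type}

/-- Substitution of trees for the leaves. -/
def bind : PTree I → (I → PTree J) → PTree J
  | leaf i, f => f i
  | node l r, f => node (l.bind f) (r.bind f)

/-- Relabelling of the leaves. -/
def map (e : I → J) (t : PTree I) : PTree J := t.bind (fun i => leaf (e i))

/-- The leaf labels from left to right. -/
def leaves : PTree I → List I
  | leaf i => [i]
  | node l r => l.leaves ++ r.leaves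

/-- The number of internal vertices. -/
def vertices : PTree I → ℕ
  | leaf _ => 0
  | node l r => 1 + l.vertices + r.vertices

/-- The tree `a ∘_* b`: the root of `b` is grafted at the leaf `*` of `a`. -/
def graft (a : PTree (Option A)) (b : PTree B) : PTree (A ⊕ B) :=
  a.bind (fun x => x.elim (b.map Sum.inr) (fun y => leaf (Sum.inl y)))

/-- Whether the label `*` occurs. -/
def hasMark : PTree (Option A) → Bool
  | leaf none => true
  | leaf (some _) => false
  | node l r => l.hasMark || r.hasMark

/-- The number of internal vertices that come after the leaf `*` when the vertices and the leaves
are listed in the planar order "root, left subtree, right subtree". -/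
def afterMark : PTree (Option A) → ℕ
  | leaf _ => 0
  | node l r => if l.hasMark then l.afterMark + r.vertices else r.afterMark

/-- Every element of `I` labels exactly one leaf. -/
def Multilinear (t : PTree I) : Prop := t.leaves.Nodup ∧ ∀ i, i ∈ t.leaves

theorem bind_bind (t : PTree I) (f : I → PTree J) (g : J → PTree K) :
    (t.bind f).bind g = t.bind (fun i => (f i).bind g) := by
  induction t with
  | leaf i => rfl
  | node l r hl hr => simp [bind, hl, hr]

theorem bind_leaf (t : PTree I) : t.bind leaf = t := by
  induction t with
  | leaf i => rfl
  | node l r hl hr => simp [bind, hl, hr]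

theorem leaves_bind (t : PTree I) (f : I → PTree J) :
    (t.bind f).leaves = t.leaves.flatMap (fun i => (f i).leaves) := by
  induction t with
  | leaf i => simp [bind, leaves]
  | node l r hl hr => simp [bind, leaves, hl, hr]

theorem leaves_map (e : I → J) (t : PTree I) : (t.map e).leaves = t.leaves.map e := by
  rw [map, leaves_bind]
  simp [leaves]
  induction t.leaves <;> simp_all

theorem vertices_map (e : I → J) (t : PTree I) : (t.map e).vertices = t.vertices := by
  induction t with
  | leaf i => rfl
  | node l r hl hr =>
    change 1 + (l.map e).vertices + (r.map e).vertices = _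
    rw [hl, hr]; rfl

theorem leaves_ne_nil (t : PTree I) : t.leaves ≠ [] := by
  induction t with
  | leaf i => simp [leaves]
  | node l r hl hr => simp [leaves, hl]

theorem map_injective {e : I → J} (he : Function.Injective e) :
    Function.Injective (map e) := by
  intro t
  induction t with
  | leaf i =>
    rintro (j | ⟨l, r⟩) h
    · simp only [map, bind, leaf.injEq] at h
      rw [he h]
    · simp [map, bind] at h
  | node l r hl hr =>
    rintro (j | ⟨l', r'⟩) h
    · simp [map, bind] at h
    · simp only [map, bind, node.injEq] at h
      rw [hl h.1, hr h.2]

theorem Multilinear.map {t : PTree I} (ht : t.Multilinear) (e : I ≃ J) :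
    (t.map e).Multilinear := by
  refine ⟨?_, fun j => ?_⟩
  · rw [leaves_map]; exact ht.1.map e.injective
  · rw [leaves_map, List.mem_map]; exact ⟨e.symm j, ht.2 _, by simp⟩

theorem Multilinear.graft {a : PTree (Option A)} {b : PTree B} (ha : a.Multilinear)
    (hb : b.Multilinear) : (a.graft b).Multilinear := by
  unfold PTree.graft
  refine ⟨?_, fun j => ?_⟩
  · rw [leaves_bind, List.nodup_flatMap]
    refine ⟨?_, ?_⟩
    · rintro (_ | x) -
      · simp only [Option.elim, leaves_map]; exact hb.1.map Sum.inr_injective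
      · simp [leaves]
    · refine ha.1.imp ?_
      rintro (_ | x) (_ | y) hxy
      · exact (hxy rfl).elim
      · simp [Function.onFun, leaves_map, leaves]
      · simp [Function.onFun, leaves_map, leaves]
      · simp only [Function.onFun, leaves, List.disjoint_left, Option.elim]
        simp
        rintro rfl; exact hxy rfl
  · rw [leaves_bind, List.mem_flatMap]
    rcases j with x | y
    · exact ⟨some x, ha.2 _, by simp [leaves]⟩
    · exact ⟨none, ha.2 _, by simp [leaves_map, hb.2]⟩

theorem map_eq_bind (e : I → J) (t : PTree I) : t.map e = t.bind (fun i => leaf (e i)) := rfl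

theorem map_id (t : PTree I) : t.map id = t := bind_leaf t

theorem map_map (e : I → J) (e' : J → K) (t : PTree I) : (t.map e).map e' = t.map (e' ∘ e) := by
  simp only [map, bind_bind]; rfl

theorem graft_map {A' B' : Type} (σ : A ≃ A') (τ : B ≃ B') (a : PTree (Option A)) (b : PTree B) :
    (a.map (Equiv.optionCongr σ)).graft (b.map τ) = (a.graft b).map (Equiv.sumCongr σ τ) := by
  simp only [map, graft, bind_bind]
  congr 1
  funext x
  rcases x with _ | x
  · simp [bind, bind_bind]
  · simp [bind]

theorem hasMark_map {A' : Type} (σ : A ≃ A') (a : PTree (Option A)) :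
    (a.map (Equiv.optionCongr σ)).hasMark = a.hasMark := by
  induction a with
  | leaf i => rcases i with _ | i <;> rfl
  | node l r hl hr =>
    change ((l.map _).hasMark || (r.map _).hasMark) = _
    rw [hl, hr]; rfl

theorem afterMark_map {A' : Type} (σ : A ≃ A') (a : PTree (Option A)) :
    (a.map (Equiv.optionCongr σ)).afterMark = a.afterMark := by
  induction a with
  | leaf i => rfl
  | node l r hl hr =>
    change (if (l.map _).hasMark then (l.map _).afterMark + (r.map _).vertices
      else (r.map _).afterMark) = _
    rw [hl, hr, hasMark_map, vertices_map]; rfl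

theorem inl_mem_graft {a : PTree (Option A)} {b : PTree B} {x : A} (h : some x ∈ a.leaves) :
    Sum.inl x ∈ (a.graft b).leaves := by
  rw [graft, leaves_bind, List.mem_flatMap]
  exact ⟨some x, h, by simp [leaves]⟩

/-- A tree in which all leaves carry the label `*`, without repetition, is a leaf. -/
theorem eq_leaf_none {a : PTree (Option A)} (hn : a.leaves.Nodup)
    (h : ∀ x : A, some x ∉ a.leaves) : a = leaf none := by
  have key : ∀ t : PTree (Option A), (∀ x : A, some x ∉ t.leaves) → none ∈ t.leaves := by
    intro t ht
    obtain ⟨y, l, hy⟩ := List.exists_cons_of_ne_nil t.leaves_ne_nil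
    rcases y with _ | y
    · simp [hy]
    · exact (ht y (by simp [hy])).elim
  rcases a with (_ | x) | ⟨l, r⟩
  · rfl
  · exact (h x (by simp [leaves])).elim
  · have hl := key l (fun x hx => h x (by simp [leaves, hx]))
    have hr := key r (fun x hx => h x (by simp [leaves, hx]))
    simp only [leaves, List.nodup_append] at hn
    exact (hn.2.2 _ hl _ hr rfl).elim

/-- A tree is obtained by grafting in at most one way with a given set of leaves on top. -/
theorem graft_injective {a a' : PTree (Option A)} {b b' : PTree B} (hn : a.leaves.Nodup)
    (hn' : a'.leaves.Nodup) (hm : none ∈ a.leaves) (h : a.graft b = a'.graft b') :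
    a = a' ∧ b = b' := by
  have root : ∀ {a' : PTree (Option A)} {b b' : PTree B}, a'.leaves.Nodup →
      (leaf none).graft b = a'.graft b' → (leaf none : PTree (Option A)) = a' ∧ b = b' := by
    intro a' b b' hn' h
    have : a' = leaf none := by
      refine eq_leaf_none hn' fun x hx => ?_
      have := inl_mem_graft (b := b') hx
      rw [← h] at this
      simp [graft, bind, leaves_map] at this
    subst this
    exact ⟨rfl, map_injective Sum.inr_injective h⟩
  have free : ∀ {a a' : PTree (Option A)} {b b' : PTree B}, none ∉ a.leaves →
      a.graft b = a'.graft b' → a = a' := by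
    intro a
    induction a with
    | leaf x =>
      intro a' b b' hx h
      rcases x with _ | x
      · simp [leaves] at hx
      · rcases a' with (_ | y) | ⟨l, r⟩
        · have := congrArg leaves h
          simp only [graft, bind, leaves_map, leaves, Option.elim] at this
          have hmem : (Sum.inl x : A ⊕ B) ∈ b'.leaves.map Sum.inr := by rw [← this]; simp
          simp at hmem
        · simpa [graft, bind] using h
        · simp [graft, bind] at h
    | node l r hl hr =>
      intro a' b b' hx h
      simp only [leaves, List.mem_append, not_or] at hx
      rcases a' with (_ | y) | ⟨l', r'⟩
      · exfalso
        obtain ⟨y, m, hy⟩ := List.exists_cons_of_ne_nil l.leaves_ne_nil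
        rcases y with _ | y
        · exact hx.1 (by simp [hy])
        · have := inl_mem_graft (b := b) (x := y) (a := node l r) (by simp [leaves, hy])
          rw [h] at this
          simp [graft, bind, leaves_map] at this
      · simp [graft, bind] at h
      · simp only [graft, bind, node.injEq] at h
        rw [hl hx.1 h.1, hr hx.2 h.2]
  induction a generalizing a' with
  | leaf x =>
    rcases x with _ | x
    · exact root hn' h
    · simp [leaves] at hm
  | node l r hl hr =>
    rcases a' with (_ | y) | ⟨l', r'⟩
    · obtain ⟨h1, h2⟩ := root hn h.symm
      exact ⟨h1.symm, h2.symm⟩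
    · simp [graft, bind] at h
    · simp only [graft, bind, node.injEq] at h
      simp only [leaves, List.nodup_append, List.mem_append] at hn hn' hm
      rcases hm with hm | hm
      · obtain ⟨h1, h2⟩ := hl hn.1 hn'.1 hm h.1
        have h3 : none ∉ r.leaves := fun hr => hn.2.2 _ hm _ hr rfl
        exact ⟨by rw [h1, free h3 h.2], h2⟩
      · obtain ⟨h1, h2⟩ := hr hn.2.1 hn'.2.1 hm h.2
        have h3 : none ∉ l.leaves := fun hl => hn.2.2 _ hl _ hm rfl
        exact ⟨by rw [h1, free h3 h.1], h2⟩

end PTree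

/-- Planar binary rooted trees whose leaves are in bijection with `I`. -/
def LTree (I : Type) : Type := {t : PTree I // t.Multilinear}

namespace LTree

variable {I J A B : Type}

def map (e : I ≃ J) (t : LTree I) : LTree J := ⟨t.1.map e, t.2.map e⟩

def graft (a : LTree (Option A)) (b : LTree B) : LTree (A ⊕ B) := ⟨a.1.graft b.1, a.2.graft b.2⟩

theorem map_refl (t : LTree I) : t.map (Equiv.refl I) = t := Subtype.ext (PTree.map_id t.1)

theorem map_trans {K : Type} (e : I ≃ J) (e' : J ≃ K) (t : LTree I) :
    t.map (e.trans e') = (t.map e).map e' := Subtype.ext (PTree.map_map e e' t.1).symm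

theorem graft_map {A' B' : Type} (σ : A ≃ A') (τ : B ≃ B') (a : LTree (Option A)) (b : LTree B) :
    (a.map (Equiv.optionCongr σ)).graft (b.map τ) = (a.graft b).map (Equiv.sumCongr σ τ) :=
  Subtype.ext (PTree.graft_map σ τ a.1 b.1)

theorem graft_injective :
    Function.Injective (fun p : LTree (Option A) × LTree B => p.1.graft p.2) := by
  rintro ⟨a, b⟩ ⟨a', b'⟩ h
  obtain ⟨h1, h2⟩ := PTree.graft_injective a.2.1 a'.2.1 (a.2.2 none) (congrArg Subtype.val h)
  exact Prod.ext (Subtype.ext h1) (Subtype.ext h2)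

/-- The tree with one leaf. -/
def one : LTree Unit := ⟨PTree.leaf (), by simp [PTree.leaves], by simp [PTree.leaves]⟩

theorem graft_one (a : LTree (Option A)) :
    a.graft one = a.map (Equiv.optionEquivSumPUnit A) := by
  apply Subtype.ext
  simp only [graft, PTree.graft, map, PTree.map]
  congr 1
  funext x
  rcases x with _ | x <;> rfl

theorem one_graft (b : LTree B) :
    (one.map (Equiv.ofUnique Unit (Option Empty))).graft b =
      b.map (Equiv.emptySum Empty B).symm := rfl

theorem graft_seq {C : Type} (a : LTree (Option A)) (b : LTree (Option B)) (c : LTree C) :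
    (((a.graft b).map (sumOption A B)).graft c).map (Equiv.sumAssoc A B C) =
      a.graft (b.graft c) := by
  apply Subtype.ext
  simp only [graft, PTree.graft, map, PTree.map, PTree.bind_bind]
  congr 1
  funext x
  rcases x with _ | x
  · simp only [Option.elim, PTree.bind_bind]
    congr 1
    funext y
    rcases y with _ | y
    · simp [PTree.bind, PTree.bind_bind, sumOption]
    · simp [PTree.bind, sumOption]
  · simp [PTree.bind, sumOption]

theorem graft_par {C : Type} (a : LTree (Option (Option A))) (b : LTree B) (c : LTree C) :
    (((a.graft b).map (optionSum A B)).graft c).map (sumSwap A B C) =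
      (((a.map (optionSwap A)).graft c).map (optionSum A C)).graft b := by
  apply Subtype.ext
  simp only [graft, PTree.graft, map, PTree.map, PTree.bind_bind]
  congr 1
  funext x
  rcases x with _ | _ | x
  · simp [PTree.bind, PTree.bind_bind, optionSum, optionSwap, sumSwap]
  · simp [PTree.bind, PTree.bind_bind, optionSum, optionSwap, sumSwap]
  · simp [PTree.bind, optionSum, optionSwap, sumSwap]

end LTree

/-- The vector space with basis the planar binary rooted trees with leaves labelled by `I`. -/
abbrev TreeMod (k : Type u) [Field k] (I : Type) : Type u := LTree I →₀ k

namespace TreeMod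

variable (k : Type u) [Field k] {I J A B : Type}

noncomputable def map (e : I ≃ J) : TreeMod k I →ₗ[k] TreeMod k J := Finsupp.lmapDomain k k (LTree.map e)

noncomputable def comp : TreeMod k (Option A) →ₗ[k] TreeMod k B →ₗ[k] TreeMod k (A ⊕ B) :=
  Finsupp.linearCombination k (fun a => Finsupp.lmapDomain k k (LTree.graft a))

@[simp] theorem map_single (e : I ≃ J) (t : LTree I) (c : k) :
    map k e (Finsupp.single t c) = Finsupp.single (t.map e) c := by
  simp [map]

@[simp] theorem comp_single (a : LTree (Option A)) (b : LTree B) (c d : k) :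
    comp k (Finsupp.single a c) (Finsupp.single b d) = Finsupp.single (a.graft b) (c * d) := by
  simp [comp]

/-- The partial decomposition `Δ_B : 𝒯ᶜ(sX)(A ⊔ B) → 𝒯ᶜ(sX)(A ⊔ {*}) ⊗ 𝒯ᶜ(sX)(B)` of the cofree
conilpotent cooperad, where `X` is the regular representation of `𝕊₂` in arity two, spanned by one
operation `x₁ x₂` without symmetries and its opposite. A basis element of `𝒯ᶜ(sX)(I)` is a planar
binary tree `t` with leaves labelled by `I`, each vertex of which carries a copy of the generator
`s(x₁ x₂)` of degree one; these factors are listed in the planar order "root, left subtree, right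
subtree". If `B` is the set of leaves above some edge of `t` then `t = a ∘_* b` for exactly one
pair `(a, b)`, and `Δ_B(t) = ± a ⊗ b`, with the Koszul sign of moving the factors of `b` to
the right of those factors of `a` that come after the leaf `*`; otherwise `Δ_B(t) = 0`. -/
noncomputable def decomp :
    TreeMod k (A ⊕ B) →ₗ[k] TreeMod k (Option A) ⊗[k] TreeMod k B :=
  open Classical in
  Finsupp.linearCombination k (fun t =>
    if h : ∃ p : LTree (Option A) × LTree B, p.1.graft p.2 = t then
      (-1 : k) ^ (h.choose.1.1.afterMark * h.choose.2.1.vertices) •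
        (Finsupp.single h.choose.1 (1 : k) ⊗ₜ[k] Finsupp.single h.choose.2 (1 : k))
    else 0)

theorem decomp_graft (a : LTree (Option A)) (b : LTree B) :
    decomp k (Finsupp.single (a.graft b) 1) =
      (-1 : k) ^ (a.1.afterMark * b.1.vertices) •
        (Finsupp.single a (1 : k) ⊗ₜ[k] Finsupp.single b (1 : k)) := by
  have h : ∃ p : LTree (Option A) × LTree B, p.1.graft p.2 = a.graft b := ⟨(a, b), rfl⟩
  have h' : h.choose = (a, b) := LTree.graft_injective h.choose_spec
  rw [decomp, Finsupp.linearCombination_single, one_smul, dif_pos h, h']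

theorem decomp_of_not (t : LTree (A ⊕ B))
    (h : ¬ ∃ p : LTree (Option A) × LTree B, p.1.graft p.2 = t) :
    decomp k (Finsupp.single t 1) = 0 := by
  rw [decomp, Finsupp.linearCombination_single, one_smul, dif_neg h]

theorem decomp_map {A' B' : Type} (σ : A ≃ A') (τ : B ≃ B') (x : TreeMod k (A ⊕ B)) :
    decomp k (map k (Equiv.sumCongr σ τ) x) =
      TensorProduct.map (map k (Equiv.optionCongr σ)) (map k τ) (decomp k x) := by
  suffices h : decomp k ∘ₗ map k (Equiv.sumCongr σ τ) =
      TensorProduct.map (map k (Equiv.optionCongr σ)) (map k τ) ∘ₗ decomp k from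
    LinearMap.congr_fun h x
  refine Finsupp.lhom_ext' fun t => LinearMap.ext_ring ?_
  simp only [LinearMap.comp_apply, Finsupp.lsingle_apply, map_single]
  by_cases h : ∃ p : LTree (Option A) × LTree B, p.1.graft p.2 = t
  · obtain ⟨⟨a, b⟩, rfl⟩ := h
    simp only [← LTree.graft_map, decomp_graft, _root_.map_smul, TensorProduct.map_tmul, map_single]
    congr 2
    change (a.1.map _).afterMark * (b.1.map _).vertices = _
    rw [PTree.afterMark_map, PTree.vertices_map]
  · rw [decomp_of_not _ _ h, _root_.map_zero, decomp_of_not]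
    rintro ⟨⟨a, b⟩, hab⟩
    refine h ⟨(a.map (Equiv.optionCongr σ.symm), b.map τ.symm), ?_⟩
    have := congrArg (LTree.map (Equiv.sumCongr σ τ).symm) hab
    rw [← LTree.map_trans, Equiv.self_trans_symm, LTree.map_refl] at this
    rw [← this, LTree.graft_map]
    rfl

end TreeMod

/-- The free operad `𝒯(X)` on one binary operation without symmetries. -/
noncomputable def FreeOp (k : Type u) [Field k] : Operad k where
  obj I _ := TreeMod k I
  map e := TreeMod.map k e
  map_refl x := by
    simp [TreeMod.map,
      show LTree.map (Equiv.refl _) = id from funext LTree.map_refl]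
  map_trans e e' x := by
    simp only [TreeMod.map, Finsupp.lmapDomain_apply, ← Finsupp.mapDomain_comp]
    exact congrArg (fun f => Finsupp.mapDomain f x) (funext (LTree.map_trans e e'))
  one := Finsupp.single LTree.one 1
  comp := TreeMod.comp k
  comp_map σ τ a b := by
    induction a using Finsupp.induction_linear with
    | zero => simp only [_root_.map_zero, LinearMap.zero_apply]
    | add a a' h h' => simp only [_root_.map_add, LinearMap.add_apply, h, h']
    | single a c =>
    induction b using Finsupp.induction_linear with
    | zero => simp only [_root_.map_zero]
    | add b b' h h' => simp only [_root_.map_add, h, h']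
    | single b d => simp only [TreeMod.comp_single, TreeMod.map_single, LTree.graft_map]
  comp_one a := by
    induction a using Finsupp.induction_linear with
    | zero => simp only [_root_.map_zero, LinearMap.zero_apply]
    | add a a' h h' => simp only [_root_.map_add, LinearMap.add_apply, h, h']
    | single a c => simp only [TreeMod.comp_single, TreeMod.map_single, LTree.graft_one, mul_one]
  one_comp b := by
    induction b using Finsupp.induction_linear with
    | zero => simp only [_root_.map_zero]
    | add b b' h h' => simp only [_root_.map_add, h, h']
    | single b c => simp only [TreeMod.comp_single, TreeMod.map_single, LTree.one_graft, one_mul]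
  assoc_seq a b c := by
    induction a using Finsupp.induction_linear with
    | zero => simp only [_root_.map_zero, LinearMap.zero_apply]
    | add a a' h h' => simp only [_root_.map_add, LinearMap.add_apply, h, h']
    | single a r =>
    induction b using Finsupp.induction_linear with
    | zero => simp only [_root_.map_zero, LinearMap.zero_apply]
    | add b b' h h' => simp only [_root_.map_add, LinearMap.add_apply, h, h']
    | single b s =>
    induction c using Finsupp.induction_linear with
    | zero => simp only [_root_.map_zero]
    | add c c' h h' => simp only [_root_.map_add, h, h']
    | single c t => simp only [TreeMod.comp_single, TreeMod.map_single, LTree.graft_seq, mul_assoc]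
  assoc_par a b c := by
    induction a using Finsupp.induction_linear with
    | zero => simp only [_root_.map_zero, LinearMap.zero_apply]
    | add a a' h h' => simp only [_root_.map_add, LinearMap.add_apply, h, h']
    | single a r =>
    induction b using Finsupp.induction_linear with
    | zero => simp only [_root_.map_zero, LinearMap.zero_apply]
    | add b b' h h' => simp only [_root_.map_add, LinearMap.add_apply, h, h']
    | single b s =>
    induction c using Finsupp.induction_linear with
    | zero => simp only [_root_.map_zero, LinearMap.zero_apply]
    | add c c' h h' => simp only [_root_.map_add, LinearMap.add_apply, h, h']
    | single c t => simp only [TreeMod.comp_single, TreeMod.map_single, LTree.graft_par, mul_right_comm]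

variable {k : Type u} [Field k]

/-- A subcooperad of the cofree conilpotent cooperad `𝒯ᶜ(sX)`: a family of subspaces that is
stable under relabelling and under all partial decompositions. -/
structure Subcooperad (k : Type u) [Field k] where
  carrier : ∀ (I : Type) [Finite I], Submodule k (TreeMod k I)
  map_mem : ∀ {I J : Type} [Finite I] [Finite J] (e : I ≃ J) (x : TreeMod k I),
    x ∈ carrier I → TreeMod.map k e x ∈ carrier J
  decomp_mem : ∀ {A B : Type} [Finite A] [Finite B] (x : TreeMod k (A ⊕ B)),
    x ∈ carrier (A ⊕ B) → TreeMod.decomp k x ∈ LinearMap.range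
      (TensorProduct.map (carrier (Option A)).subtype (carrier B).subtype)

namespace Subcooperad

variable (C : Subcooperad k) {I J A B : Type} [Finite I] [Finite J] [Finite A] [Finite B]

/-- The relabelling maps of a subcooperad. -/
noncomputable def map (e : I ≃ J) : C.carrier I →ₗ[k] C.carrier J :=
  (TreeMod.map k e).restrict (C.map_mem e)

theorem map_trans {K : Type} [Finite K] (e : I ≃ J) (e' : J ≃ K) (x : C.carrier I) :
    C.map (e.trans e') x = C.map e' (C.map e x) :=
  Subtype.ext ((FreeOp k).map_trans e e' x.1)

theorem tensor_injective : Function.Injective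
    (TensorProduct.map (C.carrier (Option A)).subtype (C.carrier B).subtype) :=
  haveI : Module.Free k (C.carrier (Option A)) := Module.Free.of_divisionRing (K := k) (V := C.carrier (Option A))
  TensorProduct.map_injective_of_flat_flat' _ _ (Submodule.subtype_injective _)
    (Submodule.subtype_injective _)

/-- The partial decompositions of a subcooperad, restricted from those of `𝒯ᶜ(sX)`. -/
noncomputable def decomp :
    C.carrier (A ⊕ B) →ₗ[k] C.carrier (Option A) ⊗[k] C.carrier B :=
  (LinearEquiv.ofInjective _ C.tensor_injective).symm.toLinearMap ∘ₗ
    (TreeMod.decomp k).restrict C.decomp_mem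

theorem decomp_spec (x : C.carrier (A ⊕ B)) :
    TensorProduct.map (C.carrier (Option A)).subtype (C.carrier B).subtype (C.decomp x) =
      TreeMod.decomp k x.1 := by
  have h := (LinearEquiv.ofInjective _ (C.tensor_injective (A := A) (B := B))).apply_symm_apply
    ((TreeMod.decomp k).restrict C.decomp_mem x)
  exact congrArg Subtype.val h

theorem decomp_map {A' B' : Type} [Finite A'] [Finite B'] (σ : A ≃ A') (τ : B ≃ B')
    (x : C.carrier (A ⊕ B)) :
    C.decomp (C.map (Equiv.sumCongr σ τ) x) =
      TensorProduct.map (C.map (Equiv.optionCongr σ)) (C.map τ) (C.decomp x) := by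
  apply C.tensor_injective
  rw [decomp_spec]
  change TreeMod.decomp k (TreeMod.map k _ x.1) = _
  rw [TreeMod.decomp_map, ← decomp_spec]
  generalize C.decomp x = z
  rw [← LinearMap.comp_apply, ← TensorProduct.map_comp]
  conv_rhs => rw [← LinearMap.comp_apply, ← TensorProduct.map_comp]
  rfl

end Subcooperad

/-- Quadratic relations among one binary operation without symmetries: an `𝕊₃`-stable
subspace `R ⊆ 𝒯(X)(3)`. -/
structure QuadraticData (k : Type u) [Field k] where
  rel : Submodule k (TreeMod k (Fin 3))
  map_mem : ∀ (e : Fin 3 ≃ Fin 3) (x : TreeMod k (Fin 3)), x ∈ rel → TreeMod.map k e x ∈ rel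

namespace QuadraticData

variable (R : QuadraticData k)

/-- The ideal `(R)` of `𝒯(X)`. -/
noncomputable def ideal : (FreeOp k).Ideal :=
  Operad.Ideal.span (FreeOp k) (Fin 3) (R.rel : Set (TreeMod k (Fin 3)))

/-- The quadratic operad `𝒫 = 𝒯(X)/(R)`. -/
noncomputable def operad : Operad k := (FreeOp k).quotient R.ideal

/-- The Koszul dual cooperad `𝒫^¡`: the largest subcooperad of `𝒯ᶜ(sX)` whose component
of weight two, that is of arity three, is contained in `s²R`. (The identification of `𝒯(X)(3)`
with the weight two part of `𝒯ᶜ(sX)` matches the bases of trees.) -/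
noncomputable def koszulDual : Subcooperad k where
  carrier I _ := ⨆ D : {D : Subcooperad k // D.carrier (Fin 3) ≤ R.rel}, D.1.carrier I
  map_mem {I J} _ _ e x hx := by
    have h : (⨆ D : {D : Subcooperad k // D.carrier (Fin 3) ≤ R.rel}, D.1.carrier I) ≤
        Submodule.comap (TreeMod.map k e)
          (⨆ D : {D : Subcooperad k // D.carrier (Fin 3) ≤ R.rel}, D.1.carrier J) :=
      iSup_le fun D y hy => Submodule.mem_iSup_of_mem D (D.1.map_mem e y hy)
    exact h hx
  decomp_mem {A B} _ _ x hx := by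
    suffices h : (⨆ D : {D : Subcooperad k // D.carrier (Fin 3) ≤ R.rel}, D.1.carrier (A ⊕ B)) ≤
        Submodule.comap (TreeMod.decomp k) (LinearMap.range (TensorProduct.map
          (⨆ D : {D : Subcooperad k // D.carrier (Fin 3) ≤ R.rel},
            D.1.carrier (Option A)).subtype
          (⨆ D : {D : Subcooperad k // D.carrier (Fin 3) ≤ R.rel}, D.1.carrier B).subtype)) from
      h hx
    refine iSup_le fun D y hy => ?_
    obtain ⟨z, hz⟩ := D.1.decomp_mem y hy
    refine ⟨TensorProduct.map
      (Submodule.inclusion (le_iSup (fun D : {D : Subcooperad k // D.carrier (Fin 3) ≤ R.rel} =>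
        D.1.carrier (Option A)) D))
      (Submodule.inclusion (le_iSup (fun D : {D : Subcooperad k // D.carrier (Fin 3) ≤ R.rel} =>
        D.1.carrier B) D)) z, ?_⟩
    rw [← hz, ← LinearMap.comp_apply, ← TensorProduct.map_comp]
    rfl

end QuadraticData

/-! ### The convolution algebra -/

/-- Finite sets. -/
abbrev FinType : Type 1 := {I : Type // Finite I}

instance (I : FinType) : Finite I.1 := I.2

/-- A finite set as a term of `FinType`. -/
abbrev fin (I : Type) [h : Finite I] : FinType := ⟨I, h⟩

/-- The homological degree of `𝒯ᶜ(sX)(I)`, the number `|I| - 1` of vertices of a binary tree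
with leaves `I`. Maps from it to a space of degree `0` have degree `-(|I| - 1)`. -/
noncomputable def arityDegree (I : Type) : ℤ := (Nat.card I : ℤ) - 1

section Convolution

variable (C : Subcooperad k) (Q : Operad k)

/-- Families of linear maps `C(I) → Q(I)`, for all finite sets `I`. -/
abbrev Family := ∀ I : FinType, C.carrier I.1 →ₗ[k] Q.obj I.1

/-- `Hom^𝕊(C, Q) = ∏_{n ≥ 1} Hom(C(n), Q(n))^{𝕊_n}`: families of linear maps
`C(I) → Q(I)`, for all finite sets `I`, that commute with all bijections of finite sets. Such a
family amounts to an `𝕊_n`-equivariant map for each `n`; the one for `n = 0` vanishes since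
`𝒯ᶜ(sX)(∅) = 0`. -/
def Conv : Submodule k (Family C Q) where
  carrier := {φ | ∀ (I J : FinType) (e : I.1 ≃ J.1) (x : C.carrier I.1),
    φ J (C.map e x) = Q.map e (φ I x)}
  add_mem' {φ ψ} hφ hψ I J e x := by simp [hφ I J e x, hψ I J e x]
  zero_mem' I J e x := by simp
  smul_mem' c φ hφ I J e x := by simp [hφ I J e x]

variable {C Q}

/-- The composite `C(I) → C(I/J) ⊗ C(J) → Q(I/J) ⊗ Q(J) → Q(I)` of the partial decomposition,
of `φ ⊗ ψ`, and of the partial composition, for a subset `J ⊆ I`, where `I/J = (I ∖ J) ⊔ {*}`. By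
the Koszul rule `(φ ⊗ ψ)(a ⊗ b) = (-1)^{|ψ| |a|} φ(a) ⊗ ψ(b)`. -/
noncomputable def convTerm (φ ψ : Family C Q) (I : FinType) (J : Set I.1) :
    C.carrier I.1 →ₗ[k] Q.obj I.1 :=
  (Int.negOnePow (arityDegree {i // i ∈ J} * arityDegree (Option {i // i ∉ J}))) •
    (Q.map (splitEquiv J).symm ∘ₗ TensorProduct.lift Q.comp ∘ₗ
      TensorProduct.map (φ (fin (Option {i // i ∉ J}))) (ψ (fin {i // i ∈ J})) ∘ₗ
        C.decomp ∘ₗ C.map (splitEquiv J))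

/-- The underlying family of `φ ◁ ψ`: the sum over all subsets `J ⊆ I`, that is over all ways
to split off one upper vertex with inputs `J`. -/
noncomputable def convSum (φ ψ : Family C Q) : Family C Q := fun I =>
  letI : Fintype (Set I.1) := Fintype.ofFinite _
  ∑ J : Set I.1, convTerm φ ψ I J

theorem Operad.map_lift_comp {A A' B B' : Type} [Finite A] [Finite A'] [Finite B] [Finite B']
    (σ : A ≃ A') (τ : B ≃ B') (z : Q.obj (Option A) ⊗[k] Q.obj B) :
    TensorProduct.lift Q.comp (TensorProduct.map (Q.map (Equiv.optionCongr σ)) (Q.map τ) z) =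
      Q.map (Equiv.sumCongr σ τ) (TensorProduct.lift Q.comp z) := by
  induction z with
  | zero => simp
  | tmul a b => simp [Q.comp_map]
  | add z w hz hw => simp [hz, hw]

theorem splitEquiv_image {I I' : Type} (e : I ≃ I') (J : Set I)
    (σ : {i // i ∉ J} ≃ {i // i ∉ e '' J}) (τ : {i // i ∈ J} ≃ {i // i ∈ e '' J})
    (hσ : ∀ i, (σ i).1 = e i.1) (hτ : ∀ i, (τ i).1 = e i.1) :
    e.trans (splitEquiv (e '' J)) = (splitEquiv J).trans (Equiv.sumCongr σ τ) := by
  ext i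
  apply (splitEquiv (e '' J)).symm.injective
  by_cases hi : i ∈ J
  · have : splitEquiv J i = Sum.inr ⟨i, hi⟩ := by
      apply (splitEquiv J).symm.injective; rw [Equiv.symm_apply_apply]; simp [splitEquiv]
    simp only [Equiv.trans_apply, this, Equiv.symm_apply_apply]
    simp [splitEquiv, hτ]
  · have : splitEquiv J i = Sum.inl ⟨i, hi⟩ := by
      apply (splitEquiv J).symm.injective; rw [Equiv.symm_apply_apply]; simp [splitEquiv]
    simp only [Equiv.trans_apply, this, Equiv.symm_apply_apply]
    simp [splitEquiv, hσ]

theorem convTerm_map {φ ψ : Family C Q} (hφ : φ ∈ Conv C Q) (hψ : ψ ∈ Conv C Q) {I I' : FinType}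
    (e : I.1 ≃ I'.1) (J : Set I.1) (x : C.carrier I.1) :
    convTerm φ ψ I' (e '' J) (C.map e x) = Q.map e (convTerm φ ψ I J x) := by
  let τ : {i // i ∈ J} ≃ {i // i ∈ e '' J} := e.subtypeEquiv (fun i => by simp)
  let σ : {i // i ∉ J} ≃ {i // i ∉ e '' J} := e.subtypeEquiv (fun i => by simp)
  have he := splitEquiv_image e J σ τ (fun _ => rfl) (fun _ => rfl)
  have he' : (splitEquiv J).symm.trans e =
      (Equiv.sumCongr σ τ).trans (splitEquiv (e '' J)).symm := by
    ext y
    apply (splitEquiv (e '' J)).injective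
    have := Equiv.congr_fun he ((splitEquiv J).symm y)
    simp only [Equiv.trans_apply, Equiv.apply_symm_apply] at this ⊢
    exact this
  have h1 : arityDegree {i // i ∈ e '' J} = arityDegree {i // i ∈ J} := by
    rw [arityDegree, arityDegree, Nat.card_congr τ]
  have h2 : arityDegree (Option {i // i ∉ e '' J}) = arityDegree (Option {i // i ∉ J}) := by
    rw [arityDegree, arityDegree, Nat.card_congr (Equiv.optionCongr σ)]
  have h3 : C.map (splitEquiv (e '' J)) (C.map e x) =
      C.map (Equiv.sumCongr σ τ) (C.map (splitEquiv J) x) := by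
    rw [← C.map_trans, he, C.map_trans]
  have h4 : ∀ z : C.carrier (Option {i // i ∉ J}) ⊗[k] C.carrier {i // i ∈ J},
      TensorProduct.map (φ (fin (Option {i // i ∉ e '' J}))) (ψ (fin {i // i ∈ e '' J}))
        (TensorProduct.map (C.map (Equiv.optionCongr σ)) (C.map τ) z) =
      TensorProduct.map (Q.map (Equiv.optionCongr σ)) (Q.map τ)
        (TensorProduct.map (φ (fin (Option {i // i ∉ J}))) (ψ (fin {i // i ∈ J})) z) := by
    intro z
    induction z with
    | zero => simp
    | tmul a b =>
      simp only [TensorProduct.map_tmul]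
      rw [hφ (fin _) (fin _) (Equiv.optionCongr σ) a, hψ (fin _) (fin _) τ b]
    | add z w hz hw => simp only [_root_.map_add, hz, hw]
  simp only [convTerm, LinearMap.smul_apply, LinearMap.comp_apply, h1, h2, h3, C.decomp_map, h4,
    Operad.map_lift_comp]
  rw [← Q.map_trans, ← he', Q.map_trans, Units.smul_def, Units.smul_def, map_zsmul]

theorem convSum_mem {φ ψ : Family C Q} (hφ : φ ∈ Conv C Q) (hψ : ψ ∈ Conv C Q) :
    convSum φ ψ ∈ Conv C Q := by
  intro I I' e x
  simp only [convSum, LinearMap.sum_apply, map_sum]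
  let _ : Fintype (Set I.1) := Fintype.ofFinite _
  let _ : Fintype (Set I'.1) := Fintype.ofFinite _
  exact (Fintype.sum_equiv (Equiv.Set.congr e) _ _
    (fun J => (convTerm_map hφ hψ e J x).symm)).symm

/-- The convolution pre-Lie product `φ ◁ ψ` on `Hom^𝕊(C, Q)`. -/
noncomputable def preLie : Conv C Q →ₗ[k] Conv C Q →ₗ[k] Conv C Q :=
  LinearMap.mk₂ k (fun φ ψ => ⟨convSum φ.1 ψ.1, convSum_mem φ.2 ψ.2⟩)
    (fun φ φ' ψ => Subtype.ext <| funext fun I => by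
      simp [convSum, convTerm, TensorProduct.map_add_left, LinearMap.add_comp, LinearMap.comp_add,
        Finset.sum_add_distrib])
    (fun c φ ψ => Subtype.ext <| funext fun I => by
      simp [convSum, convTerm, TensorProduct.map_smul_left, LinearMap.smul_comp,
        LinearMap.comp_smul, Finset.smul_sum, smul_comm _ c])
    (fun φ ψ ψ' => Subtype.ext <| funext fun I => by
      simp [convSum, convTerm, TensorProduct.map_add_right, LinearMap.add_comp,
        LinearMap.comp_add, Finset.sum_add_distrib])
    (fun c φ ψ => Subtype.ext <| funext fun I => by
      simp [convSum, convTerm, TensorProduct.map_smul_right, LinearMap.smul_comp,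
        LinearMap.comp_smul, Finset.smul_sum, smul_comm _ c])

variable (C Q) in
/-- The homogeneous elements of degree `j` of `Hom^𝕊(C, Q)`: since `C(n)` is concentrated in
degree `n - 1` and `Q(n)` in degree `0`, these are the families supported in arity `n = 1 - j`. -/
def Conv.degree (j : ℤ) : Submodule k (Conv C Q) where
  carrier := {φ | ∀ I : FinType, -arityDegree I.1 ≠ j → φ.1 I = 0}
  add_mem' {φ ψ} hφ hψ I h := by simp [hφ I h, hψ I h]
  zero_mem' I h := rfl
  smul_mem' c φ hφ I h := by simp [hφ I h]

/-- The Lie bracket `[φ, ψ] = φ ◁ ψ - (-1)^{pq} ψ ◁ φ` of homogeneous elements `φ` of degree `p`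
and `ψ` of degree `q` of the convolution algebra. -/
noncomputable def bracket (p q : ℤ) : Conv C Q →ₗ[k] Conv C Q →ₗ[k] Conv C Q :=
  LinearMap.mk₂ k (fun φ ψ => preLie φ ψ - Int.negOnePow (p * q) • preLie ψ φ)
    (fun φ φ' ψ => by simp only [_root_.map_add, LinearMap.add_apply, smul_add]; abel)
    (fun c φ ψ => by
      simp only [_root_.map_smul, LinearMap.smul_apply, smul_sub, smul_comm _ c])
    (fun φ ψ ψ' => by simp only [_root_.map_add, LinearMap.add_apply, smul_add]; abel)
    (fun c φ ψ => by
      simp only [_root_.map_smul, LinearMap.smul_apply, smul_sub, smul_comm _ c])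

end Convolution

/-! ### Deformation complexes -/

section Deformation

variable {R : QuadraticData k} {Q : Operad k}

open Classical in
/-- The Maurer--Cartan element `α` of degree `-1` of a morphism `f : 𝒫 → 𝒬`, for
`𝒫 = 𝒯(X)/(R)`: the composite `𝒫^¡ → 𝒯ᶜ(sX) → sX → X → 𝒫 → 𝒬` of the inclusion, the projection
onto the cogenerators (the component of arity two), the desuspension, the inclusion of the
generators and `f`. It corresponds to `𝒫_∞ → 𝒫 → 𝒬`. -/
noncomputable def mcElement (f : R.operad.Hom Q) : Conv R.koszulDual Q :=
  ⟨fun I => if Nat.card I.1 = 2 then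
      f.app I.1 ∘ₗ ((FreeOp k).quotientMk R.ideal).app I.1 ∘ₗ (R.koszulDual.carrier I.1).subtype
    else 0, by
    intro I J e x
    by_cases h : Nat.card I.1 = 2
    · have h' : Nat.card J.1 = 2 := (Nat.card_congr e).symm.trans h
      simp only [if_pos h, if_pos h', LinearMap.comp_apply]
      rw [← f.app_map]
      rfl
    · have h' : Nat.card J.1 ≠ 2 := fun h' => h ((Nat.card_congr e).trans h')
      simp [if_neg h, if_neg h']⟩

/-- The differential `d_α = [α, -]` of the deformation complex of `f`, on elements of
degree `j`. -/
noncomputable def defDifferential (f : R.operad.Hom Q) (j : ℤ) :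
    Conv R.koszulDual Q →ₗ[k] Conv R.koszulDual Q :=
  bracket (-1) j (mcElement f)

/-- The component of degree `j` of the deformation complex of `f`. -/
noncomputable abbrev defDegree (_f : R.operad.Hom Q) (j : ℤ) : Submodule k (Conv R.koszulDual Q) :=
  Conv.degree R.koszulDual Q j

/-- The deformation complex of `f` (homological grading, differential of degree `-1`) is acyclic:
in each degree the cycles are exactly the boundaries. In particular `d_α` has degree `-1` and
squares to zero. -/
def DeformationAcyclic (f : R.operad.Hom Q) : Prop :=
  ∀ j : ℤ, defDegree f j ⊓ LinearMap.ker (defDifferential f j) =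
    (defDegree f (j + 1)).map (defDifferential f (j + 1))

end Deformation

/-! ### The operad `PL` and its projection to `Com` -/

section PreLie

/-- The tree `(x_a x_b) x_c`, where `a, b, c = σ(0), σ(1), σ(2)`. -/
def leftComb (σ : Fin 3 ≃ Fin 3) : LTree (Fin 3) :=
  LTree.map σ ⟨.node (.node (.leaf 0) (.leaf 1)) (.leaf 2),
    by simp [PTree.leaves], by simp [PTree.leaves, Fin.forall_fin_succ]⟩

/-- The tree `x_a (x_b x_c)`, where `a, b, c = σ(0), σ(1), σ(2)`. -/
def rightComb (σ : Fin 3 ≃ Fin 3) : LTree (Fin 3) :=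
  LTree.map σ ⟨.node (.leaf 0) (.node (.leaf 1) (.leaf 2)),
    by simp [PTree.leaves], by simp [PTree.leaves, Fin.forall_fin_succ]⟩

variable (k) in
/-- The pre-Lie (right-symmetric) relation
`(x_a x_b) x_c - x_a (x_b x_c) - ((x_a x_c) x_b - x_a (x_c x_b))`. -/
noncomputable def preLieRelator (σ : Fin 3 ≃ Fin 3) : TreeMod k (Fin 3) :=
  (Finsupp.single (leftComb σ) 1 - Finsupp.single (rightComb σ) 1) -
    (Finsupp.single (leftComb ((Equiv.swap 1 2).trans σ)) 1 -
      Finsupp.single (rightComb ((Equiv.swap 1 2).trans σ)) 1)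

theorem map_preLieRelator (e σ : Fin 3 ≃ Fin 3) :
    TreeMod.map k e (preLieRelator k σ) = preLieRelator k (σ.trans e) := by
  have hl : ∀ τ : Fin 3 ≃ Fin 3, (leftComb τ).map e = leftComb (τ.trans e) := fun τ =>
    (LTree.map_trans τ e _).symm
  have hr : ∀ τ : Fin 3 ≃ Fin 3, (rightComb τ).map e = rightComb (τ.trans e) := fun τ =>
    (LTree.map_trans τ e _).symm
  simp only [preLieRelator, _root_.map_sub, TreeMod.map_single, hl, hr, Equiv.trans_assoc]

variable (k)

/-- The quadratic presentation of the operad of pre-Lie algebras: one binary operation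
`x₁ x₂ = x₁ ◁ x₂` without symmetries, with the pre-Lie relations. -/
noncomputable def preLieData : QuadraticData k where
  rel := Submodule.span k (Set.range (preLieRelator k))
  map_mem e x hx := by
    suffices h : Submodule.span k (Set.range (preLieRelator k)) ≤
        Submodule.comap (TreeMod.map k e) (Submodule.span k (Set.range (preLieRelator k))) from
      h hx
    rw [Submodule.span_le]
    rintro _ ⟨σ, rfl⟩
    rw [SetLike.mem_coe, Submodule.mem_comap, map_preLieRelator]
    exact Submodule.subset_span ⟨_, rfl⟩

/-- The operad `PL` of pre-Lie algebras. -/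
noncomputable def PL : Operad k := (preLieData k).operad

/-- The linear map that sends every tree to `1`. -/
noncomputable def augmentation (I : Type) : TreeMod k I →ₗ[k] k :=
  Finsupp.linearCombination k (fun _ : LTree I => (1 : k))

theorem augmentation_single (I : Type) (t : LTree I) (c : k) :
    augmentation k I (Finsupp.single t c) = c := by
  simp [augmentation]

theorem augmentation_of_isEmpty {I : Type} (h : IsEmpty I) (x : TreeMod k I) :
    augmentation k I x = 0 := by
  have : IsEmpty (LTree I) := ⟨fun t => by
    obtain ⟨i, l, -⟩ := List.exists_cons_of_ne_nil t.1.leaves_ne_nil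
    exact h.false i⟩
  rw [Subsingleton.elim x 0, _root_.map_zero]

theorem augmentation_map {I J : Type} (e : I ≃ J) (x : TreeMod k I) :
    augmentation k J (TreeMod.map k e x) = augmentation k I x := by
  induction x using Finsupp.induction_linear with
  | zero => simp only [_root_.map_zero]
  | add x y hx hy => simp only [_root_.map_add, hx, hy]
  | single t c => simp only [TreeMod.map_single, augmentation_single]

theorem augmentation_comp {A B : Type} (a : TreeMod k (Option A)) (b : TreeMod k B) :
    augmentation k (A ⊕ B) (TreeMod.comp k a b) =
      augmentation k (Option A) a * augmentation k B b := by
  induction a using Finsupp.induction_linear with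
  | zero => simp only [_root_.map_zero, LinearMap.zero_apply, zero_mul]
  | add a a' h h' => simp only [_root_.map_add, LinearMap.add_apply, h, h', add_mul]
  | single a c =>
  induction b using Finsupp.induction_linear with
  | zero => simp only [_root_.map_zero, mul_zero]
  | add b b' h h' => simp only [_root_.map_add, h, h', mul_add]
  | single b d => simp only [TreeMod.comp_single, augmentation_single]

/-- The morphism `𝒯(X) → Com` that sends the generator to the commutative product: every tree is
sent to `1`. -/
noncomputable def freeToCom : (FreeOp k).Hom (Com k) where
  app I _ := LinearMap.codRestrict _ (augmentation k I)
    (fun x hI => augmentation_of_isEmpty k hI x)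
  app_map e x := Subtype.ext (augmentation_map k e x)
  app_one := Subtype.ext (augmentation_single k Unit LTree.one 1)
  app_comp a b := Subtype.ext (augmentation_comp k a b)

theorem freeToCom_relator (σ : Fin 3 ≃ Fin 3) :
    (freeToCom k).app (Fin 3) (preLieRelator k σ) = 0 := by
  apply Subtype.ext
  change augmentation k (Fin 3) (preLieRelator k σ) = 0
  simp only [preLieRelator, _root_.map_sub, augmentation_single, sub_self]

/-- The projection `PL → Com`, which sends the pre-Lie product to the commutative product. -/
noncomputable def projPLCom : (PL k).Hom (Com k) :=
  Operad.quotientLift (preLieData k).ideal (freeToCom k) (fun I _ =>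
    iInf_le_of_le ⟨(freeToCom k).ker, by
      change ((preLieData k).rel : Set (TreeMod k (Fin 3))) ⊆
        (LinearMap.ker ((freeToCom k).app (Fin 3)) : Submodule k (TreeMod k (Fin 3)))
      rw [SetLike.coe_subset_coe, preLieData, Submodule.span_le]
      rintro _ ⟨σ, rfl⟩
      exact freeToCom_relator k σ⟩ le_rfl)

end PreLie

end PreLieDef

/-! Since `Com(n)` carries the trivial action, an equivariant `φ : PL^¡(n) → Com(n)` satisfies `n!
φ(x) = φ(∑ σ x)`. In characteristic zero it therefore vanishes as soon as the symmetrization of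
every element of `PL^¡(n)` is zero. The coefficient of this symmetrization at a tree `t` is
`orbitSum t x`, and the heart of the proof is `orbitSum_koszulDual`: it is zero for every `t` once
`n ≥ 3`.

This goes by induction on `n`. For `n = 3` each relator is a difference of two elements in the same
orbit. For `n ≥ 4`, if a subtree at the root has at least three leaves, decompose along it: the
upper tensor factor lies in `PL^¡` in smaller arity, where symmetrization gives zero, and averaging
over the larger group extends this to the whole tree (`orbitSum_graft_eq_zero`). The only trees left
are those of shape `(p q)(r s)`. For them the lower factor `(p q) *` has three leaves, and the
quadratic relations say that its coefficient is minus that of `(p *) q` (`coeff_preLieRelator`).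
This trades `(p q)(r s)` for `(p (r s)) q`, whose left subtree has three leaves.

In arities one and two `PL^¡` contains all trees (`mem_koszulDual`) and relabelling permutes them
transitively, so the equivariant maps are the multiples of `arityProj 1` and of `arityProj 2 = α`.
Finally `d(arityProj 1) = 2α - α = α`: the identity can be inserted at the two inputs of a binary
vertex, but at only one output. -/

namespace PreLieDef

/-! ### Leaf counts, and splitting a tree at its root. -/

section Trees

variable {I J A B : Type}

/-- Applied to inclusions of subsets of labels, this turns a subtree into a tree labelled by its own
leaf set. -/
theorem PTree.exists_map_eq (f : A → I) (t : PTree I) (h : ∀ i ∈ t.leaves, ∃ a, f a = i) :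
    ∃ s : PTree A, s.map f = t := by
  induction t with
  | leaf i =>
    obtain ⟨a, rfl⟩ := h i (by simp [PTree.leaves])
    exact ⟨.leaf a, rfl⟩
  | node l r hl hr =>
    obtain ⟨s, rfl⟩ := hl fun i hi => h i (by simp [PTree.leaves, hi])
    obtain ⟨s', rfl⟩ := hr fun i hi => h i (by simp [PTree.leaves, hi])
    exact ⟨.node s s', rfl⟩

theorem PTree.map_node (f : I → J) (l r : PTree I) :
    (PTree.node l r).map f = .node (l.map f) (r.map f) := rfl

theorem PTree.bind_map (f : I → J) (g : J → PTree A) (t : PTree I) :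
    (t.map f).bind g = t.bind (g ∘ f) := PTree.bind_bind t _ g

theorem PTree.graft_map_some (a : PTree A) (b : PTree B) :
    (a.map some).graft b = a.map Sum.inl := PTree.bind_map _ _ _

theorem PTree.graft_node_left (a : PTree A) (b : PTree B) :
    (PTree.node (.leaf none) (a.map some)).graft b = .node (b.map Sum.inr) (a.map Sum.inl) := by
  rw [← PTree.graft_map_some a b]; rfl

theorem PTree.graft_node_right (a : PTree A) (b : PTree B) :
    (PTree.node (a.map some) (.leaf none)).graft b = .node (a.map Sum.inl) (b.map Sum.inr) := by
  rw [← PTree.graft_map_some a b]; rfl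

theorem PTree.length_leaves_pos (t : PTree I) : 0 < t.leaves.length :=
  List.length_pos_iff.mpr t.leaves_ne_nil

theorem PTree.length_leaves (t : PTree I) : t.leaves.length = t.vertices + 1 := by
  induction t with
  | leaf i => rfl
  | node l r hl hr => simp only [PTree.leaves, List.length_append, PTree.vertices, hl, hr]; omega

theorem PTree.exists_eq_leaf {t : PTree I} (h : t.leaves.length = 1) : ∃ i, t = .leaf i := by
  rcases t with i | ⟨l, r⟩
  · exact ⟨i, rfl⟩
  · have := l.length_leaves_pos
    have := r.length_leaves_pos
    simp only [PTree.leaves, List.length_append] at h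
    omega

theorem PTree.exists_eq_node {t : PTree I} (h : t.leaves.length = 2) :
    ∃ i j, t = .node (.leaf i) (.leaf j) := by
  rcases t with i | ⟨l, r⟩
  · simp [PTree.leaves] at h
  · have := l.length_leaves_pos
    have := r.length_leaves_pos
    simp only [PTree.leaves, List.length_append] at h
    obtain ⟨i, rfl⟩ := PTree.exists_eq_leaf (t := l) (by omega)
    obtain ⟨j, rfl⟩ := PTree.exists_eq_leaf (t := r) (by omega)
    exact ⟨i, j, rfl⟩

theorem LTree.length_leaves (t : LTree I) : t.1.leaves.length = Nat.card I := by
  classical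
  -- The finiteness of `I` is read off from the list of leaves, so that `univ` is
  -- `t.1.leaves.toFinset` by definition.
  let _ : Fintype I := ⟨t.1.leaves.toFinset, fun i => List.mem_toFinset.mpr (t.2.2 i)⟩
  rw [Nat.card_eq_fintype_card, ← List.toFinset_card_of_nodup t.2.1]
  rfl

theorem LTree.vertices_add_one (t : LTree I) : t.1.vertices + 1 = Nat.card I := by
  rw [← t.length_leaves, PTree.length_leaves]

theorem LTree.map_injective (e : I ≃ J) : Function.Injective (LTree.map e) := fun _ _ h =>
  Subtype.ext (PTree.map_injective e.injective (congrArg Subtype.val h))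

theorem LTree.graft_map_right (a : LTree (Option A)) (b : LTree B) (τ : B ≃ B) :
    a.graft (b.map τ) = (a.graft b).map (Equiv.sumCongr (Equiv.refl A) τ) := by
  rw [← LTree.graft_map, Equiv.optionCongr_refl, LTree.map_refl]

theorem splitEquiv_symm_inl (S : Set I) (i : {i // i ∉ S}) :
    (splitEquiv S).symm (Sum.inl i) = i.1 := by simp [splitEquiv]

theorem splitEquiv_symm_inr (S : Set I) (i : {i // i ∈ S}) :
    (splitEquiv S).symm (Sum.inr i) = i.1 := by simp [splitEquiv]

/-- A tree is obtained by grafting its left subtree. -/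
theorem LTree.exists_graft_left [Finite I] (t : LTree I) {l r : PTree I} (h : t.1 = .node l r) :
    ∃ (A B : Type) (_ : Finite A) (_ : Finite B) (e : A ⊕ B ≃ I) (a : LTree (Option A))
      (b : LTree B), (a.graft b).map e = t ∧ Nat.card B = l.leaves.length := by
  obtain ⟨hn, hm⟩ := t.2
  simp only [h, PTree.leaves, List.nodup_append, List.mem_append] at hn hm
  -- The leaves of the left subtree become `B` and the remaining ones become `A`; the lower tree is
  -- a root vertex with the mark as its left input.
  let S : Set I := {i | i ∈ l.leaves}
  obtain ⟨b, hb⟩ := l.exists_map_eq (Subtype.val : {i // i ∈ S} → I) fun i hi => ⟨⟨i, hi⟩, rfl⟩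
  obtain ⟨a, ha⟩ := r.exists_map_eq (Subtype.val : {i // i ∉ S} → I) fun i hi =>
    ⟨⟨i, fun hi' => hn.2.2 _ hi' _ hi rfl⟩, rfl⟩
  have hbl : b.leaves.map Subtype.val = l.leaves := by rw [← PTree.leaves_map, hb]
  have hal : a.leaves.map Subtype.val = r.leaves := by rw [← PTree.leaves_map, ha]
  have hbm : b.Multilinear := by
    refine ⟨List.Nodup.of_map Subtype.val (hbl ▸ hn.1), fun i => ?_⟩
    have : i.1 ∈ b.leaves.map Subtype.val := hbl ▸ i.2
    simpa using this
  have ham : (PTree.node (.leaf none) (a.map some)).Multilinear := by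
    refine ⟨?_, ?_⟩
    · simp only [PTree.leaves, PTree.leaves_map]
      simpa using (List.Nodup.of_map Subtype.val (hal ▸ hn.2.1)).map (Option.some_injective _)
    · rintro (_ | i)
      · simp [PTree.leaves]
      · have : i.1 ∈ a.leaves.map Subtype.val := hal ▸ (hm i.1).resolve_left i.2
        simpa [PTree.leaves, PTree.leaves_map, i.2] using this
  refine ⟨_, _, inferInstance, inferInstance, (splitEquiv S).symm, ⟨_, ham⟩, ⟨b, hbm⟩, ?_, ?_⟩
  · apply Subtype.ext
    rw [h, ← ha, ← hb]
    change ((PTree.node (.leaf none) (a.map some)).graft b).map _ = _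
    rw [PTree.graft_node_left, PTree.map_node, PTree.map_map, PTree.map_map]
    exact congrArg₂ (fun f g => PTree.node (b.map f) (a.map g))
      (funext (splitEquiv_symm_inr S)) (funext (splitEquiv_symm_inl S))
  · rw [← hbl, List.length_map]
    exact (LTree.length_leaves ⟨b, hbm⟩).symm

/-- A tree is obtained by grafting its right subtree. -/
theorem LTree.exists_graft_right [Finite I] (t : LTree I) {l r : PTree I} (h : t.1 = .node l r) :
    ∃ (A B : Type) (_ : Finite A) (_ : Finite B) (e : A ⊕ B ≃ I) (a : LTree (Option A))
      (b : LTree B), (a.graft b).map e = t ∧ Nat.card B = r.leaves.length ∧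
        ∃ a' : PTree A, a.1 = .node (a'.map some) (.leaf none) := by
  obtain ⟨hn, hm⟩ := t.2
  simp only [h, PTree.leaves, List.nodup_append, List.mem_append] at hn hm
  let S : Set I := {i | i ∈ r.leaves}
  obtain ⟨b, hb⟩ := r.exists_map_eq (Subtype.val : {i // i ∈ S} → I) fun i hi => ⟨⟨i, hi⟩, rfl⟩
  obtain ⟨a, ha⟩ := l.exists_map_eq (Subtype.val : {i // i ∉ S} → I) fun i hi =>
    ⟨⟨i, fun hi' => hn.2.2 _ hi _ hi' rfl⟩, rfl⟩
  have hbl : b.leaves.map Subtype.val = r.leaves := by rw [← PTree.leaves_map, hb]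
  have hal : a.leaves.map Subtype.val = l.leaves := by rw [← PTree.leaves_map, ha]
  have hbm : b.Multilinear := by
    refine ⟨List.Nodup.of_map Subtype.val (hbl ▸ hn.2.1), fun i => ?_⟩
    have : i.1 ∈ b.leaves.map Subtype.val := hbl ▸ i.2
    simpa using this
  have ham : (PTree.node (a.map some) (.leaf none)).Multilinear := by
    refine ⟨?_, ?_⟩
    · simp only [PTree.leaves, PTree.leaves_map, List.nodup_append]
      refine ⟨(List.Nodup.of_map Subtype.val (hal ▸ hn.1)).map (Option.some_injective _), ?_⟩
      refine ⟨by simp, fun x hx y hy => ?_⟩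
      obtain ⟨z, -, rfl⟩ := List.mem_map.mp hx
      simp_all
    · rintro (_ | i)
      · simp [PTree.leaves]
      · have : i.1 ∈ a.leaves.map Subtype.val := hal ▸ (hm i.1).resolve_right i.2
        simpa [PTree.leaves, PTree.leaves_map, i.2] using this
  -- Here the shape of the lower tree is recorded too: the quadratic relations are applied to it
  -- when both subtrees are small.
  refine ⟨_, _, inferInstance, inferInstance, (splitEquiv S).symm, ⟨_, ham⟩, ⟨b, hbm⟩, ?_, ?_,
    a, rfl⟩
  · apply Subtype.ext
    rw [h, ← ha, ← hb]
    change ((PTree.node (a.map some) (.leaf none)).graft b).map _ = _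
    rw [PTree.graft_node_right, PTree.map_node, PTree.map_map, PTree.map_map]
    exact congrArg₂ (fun f g => PTree.node (a.map f) (b.map g))
      (funext (splitEquiv_symm_inl S)) (funext (splitEquiv_symm_inr S))
  · rw [← hbl, List.length_map]
    exact (LTree.length_leaves ⟨b, hbm⟩).symm

end Trees

/-! ### Coefficients of decompositions and of symmetrizations. -/

section OrbitSums

variable {k : Type u} [Field k] {I J A B : Type}

theorem TreeMod.map_apply (e : I ≃ J) (x : TreeMod k I) (t : LTree I) :
    TreeMod.map k e x (t.map e) = x t :=
  Finsupp.mapDomain_apply (LTree.map_injective e) x t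

/-- The coefficients of the partial decomposition. -/
theorem TreeMod.coeff_decomp (a : LTree (Option A)) (b : LTree B) (x : TreeMod k (A ⊕ B)) :
    LinearMap.mul' k k (TensorProduct.map (Finsupp.lapply a) (Finsupp.lapply b)
      (TreeMod.decomp k x)) = (-1) ^ (a.1.afterMark * b.1.vertices) * x (a.graft b) := by
  classical
  induction x using Finsupp.induction_linear with
  | zero => simp
  | add x y hx hy => simp only [_root_.map_add, hx, hy, Finsupp.add_apply, mul_add]
  | single t c =>
    rw [← mul_one c, ← smul_eq_mul, ← Finsupp.smul_single, _root_.map_smul, _root_.map_smul,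
      _root_.map_smul, Finsupp.smul_apply, mul_smul_comm]
    congr 1
    -- Grafting is injective on pairs, so the only tree that contributes to the coefficient of `a ⊗
    -- b` is `a.graft b`.
    by_cases h : ∃ p : LTree (Option A) × LTree B, p.1.graft p.2 = t
    · obtain ⟨⟨a', b'⟩, rfl⟩ := h
      rw [TreeMod.decomp_graft]
      by_cases hab : (a', b') = (a, b)
      · obtain ⟨rfl, rfl⟩ := Prod.mk.injEq .. ▸ hab
        simp
      · rw [Finsupp.single_eq_of_ne fun h => hab (LTree.graft_injective h.symm)]
        simp only [_root_.map_smul, TensorProduct.map_tmul, LinearMap.mul'_apply,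
          Finsupp.lapply_apply, Finsupp.single_apply, mul_zero]
        by_cases ha : a' = a
        · rw [if_neg fun hb : b' = b => hab (Prod.ext ha hb)]; simp
        · rw [if_neg ha]; simp
    · rw [TreeMod.decomp_of_not k t h, Finsupp.single_eq_of_ne fun h' => h ⟨(a, b), h'⟩]
      simp

/-- The decomposition lands in `C ⊗ C`, so a functional that is zero on one factor kills it. All
information about higher arities is obtained from lower ones in this way. -/
theorem Subcooperad.map_decomp_eq_zero [Finite A] [Finite B] (C : Subcooperad k)
    (f : TreeMod k (Option A) →ₗ[k] k) (g : TreeMod k B →ₗ[k] k)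
    (h : (∀ y ∈ C.carrier (Option A), f y = 0) ∨ ∀ y ∈ C.carrier B, g y = 0)
    {x : TreeMod k (A ⊕ B)} (hx : x ∈ C.carrier (A ⊕ B)) :
    LinearMap.mul' k k (TensorProduct.map f g (TreeMod.decomp k x)) = 0 := by
  obtain ⟨z, hz⟩ := C.decomp_mem x hx
  rw [← hz]
  clear hz
  induction z with
  | zero => simp
  | add z w hz hw => simp only [_root_.map_add, hz, hw, add_zero]
  | tmul y y' =>
    rcases h with h | h
    · simp [h _ y.2]
    · simp [h _ y'.2]

/-- The sum of the coefficients of all relabellings of a tree. -/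
noncomputable def orbitSum [Finite I] (t : LTree I) : TreeMod k I →ₗ[k] k :=
  letI : Fintype (I ≃ I) := Fintype.ofFinite _
  ∑ σ : I ≃ I, Finsupp.lapply (t.map σ)

theorem orbitSum_apply [Finite I] [Fintype (I ≃ I)] (t : LTree I) (x : TreeMod k I) :
    orbitSum t x = ∑ σ : I ≃ I, x (t.map σ) := by
  simp only [orbitSum, LinearMap.sum_apply, Finsupp.lapply_apply]
  congr!

theorem orbitSum_map_left [Finite I] (t : LTree I) (τ : I ≃ I) :
    (orbitSum (t.map τ) : TreeMod k I →ₗ[k] k) = orbitSum t := by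
  refine LinearMap.ext fun x => ?_
  let _ : Fintype (I ≃ I) := Fintype.ofFinite _
  simp only [orbitSum_apply, ← LTree.map_trans]
  -- The substitution is translation of the group by `τ`.
  exact Fintype.sum_equiv (Equiv.equivCongr τ (Equiv.refl I)).symm _ _ fun σ => rfl

theorem orbitSum_map_map [Finite I] [Finite J] (t : LTree I) (e : I ≃ J) (x : TreeMod k I) :
    orbitSum (t.map e) (TreeMod.map k e x) = orbitSum t x := by
  let _ : Fintype (I ≃ I) := Fintype.ofFinite _
  let _ : Fintype (J ≃ J) := Fintype.ofFinite _
  simp only [orbitSum_apply]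
  -- Permutations of `I` and of `J` are matched by conjugation with `e`.
  refine (Fintype.sum_equiv (Equiv.equivCongr e e) _ _ fun σ => ?_).symm
  rw [← TreeMod.map_apply e x, ← LTree.map_trans, ← LTree.map_trans]
  congr 2
  ext i
  simp

theorem orbitSum_map_right [Finite I] (t : LTree I) (τ : I ≃ I) (x : TreeMod k I) :
    orbitSum t (TreeMod.map k τ x) = orbitSum t x := by
  rw [← orbitSum_map_map t τ x, orbitSum_map_left]

/-- `C` is stable under relabelling, so the relation between the two coefficients also holds at
`t.map σ` and `t'.map σ` for each `σ`; these relations are added up. -/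
theorem Subcooperad.orbitSum_eq_zero_of_coeff [Finite I] (C : Subcooperad k) {t t' : LTree I}
    (c c' : k) (h : ∀ x ∈ C.carrier I, c * x t + c' * x t' = 0) :
    ∀ x ∈ C.carrier I, c * orbitSum t x + c' * orbitSum t' x = 0 := by
  intro x hx
  let _ : Fintype (I ≃ I) := Fintype.ofFinite _
  simp only [orbitSum_apply, Finset.mul_sum, ← Finset.sum_add_distrib]
  refine Finset.sum_eq_zero fun σ _ => ?_
  have := h _ (C.map_mem σ.symm x hx)
  have key : ∀ s : LTree I, TreeMod.map k σ.symm x s = x (s.map σ) := fun s => by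
    rw [← TreeMod.map_apply σ.symm x, ← LTree.map_trans, Equiv.self_trans_symm, LTree.map_refl]
  rwa [key, key] at this

/-- Pairing the decomposition with the coefficient of `a` and with `orbitSum b` shows that the
coefficients of `x` at the trees `a.graft (b.map τ)` add up to zero. These trees lie in a single
orbit of the permutations of `A ⊕ B`, so summing over that group gives the number of permutations of
`B` times the wanted orbit sum, and characteristic zero allows division. -/
theorem Subcooperad.orbitSum_graft_eq_zero [CharZero k] [Finite A] [Finite B]
    (C : Subcooperad k) (a : LTree (Option A)) (b : LTree B)
    (hb : ∀ y ∈ C.carrier B, orbitSum b y = 0) :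
    ∀ x ∈ C.carrier (A ⊕ B), orbitSum (a.graft b) x = 0 := by
  intro x hx
  let _ : Fintype (B ≃ B) := Fintype.ofFinite _
  let _ : Fintype (A ⊕ B ≃ A ⊕ B) := Fintype.ofFinite _
  have key : ∀ x ∈ C.carrier (A ⊕ B), ∑ τ : B ≃ B, x (a.graft (b.map τ)) = 0 := by
    intro x hx
    have h := C.map_decomp_eq_zero (Finsupp.lapply a) (orbitSum b) (.inr hb) hx
    have h' : (orbitSum b : TreeMod k B →ₗ[k] k) = ∑ τ : B ≃ B, Finsupp.lapply (b.map τ) := by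
      refine LinearMap.ext fun y => ?_
      simp [orbitSum_apply]
    have h'' : ∀ z : TreeMod k (Option A) ⊗[k] TreeMod k B,
        LinearMap.mul' k k (TensorProduct.map (Finsupp.lapply a) (orbitSum b) z) =
        ∑ τ : B ≃ B, LinearMap.mul' k k
          (TensorProduct.map (Finsupp.lapply a) (Finsupp.lapply (b.map τ)) z) := by
      intro z
      rw [h']
      induction z with
      | zero => simp
      | add z w hz hw => simp only [_root_.map_add, hz, hw, Finset.sum_add_distrib]
      | tmul y y' => simp [Finset.mul_sum]
    rw [h''] at h
    -- The Koszul sign is the same for all `τ`, because relabelling preserves the number of vertices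
    -- of `b`; it factors out.
    simp only [TreeMod.coeff_decomp, ← Finset.mul_sum,
      show ∀ τ : B ≃ B, (b.map τ).1.vertices = b.1.vertices from fun τ => PTree.vertices_map _ _]
      at h
    exact (mul_eq_zero.mp h).resolve_left (pow_ne_zero _ (neg_ne_zero.mpr one_ne_zero))
  have h1 : ∑ τ : B ≃ B, orbitSum (a.graft (b.map τ)) x = 0 := by
    simp only [orbitSum_apply]
    rw [Finset.sum_comm]
    refine Finset.sum_eq_zero fun σ _ => ?_
    refine Eq.trans (Finset.sum_congr rfl fun τ _ => ?_) (key _ (C.map_mem σ.symm x hx))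
    rw [← TreeMod.map_apply σ.symm x, ← LTree.map_trans, Equiv.self_trans_symm, LTree.map_refl]
  simp only [LTree.graft_map_right, orbitSum_map_left, Finset.sum_const, nsmul_eq_mul] at h1
  refine (mul_eq_zero.mp h1).resolve_left ?_
  rw [Finset.card_univ]
  exact Nat.cast_ne_zero.mpr Fintype.card_ne_zero

end OrbitSums

/-! ### Vanishing of symmetrizations in arity at least three. -/

section KoszulDual

variable {k : Type u} [Field k] {I J A B : Type}

theorem koszulDual_carrier_le (R : QuadraticData k) : R.koszulDual.carrier (Fin 3) ≤ R.rel :=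
  iSup_le fun D => D.2

theorem leftComb_eq_map (σ τ : Fin 3 ≃ Fin 3) :
    leftComb (σ.trans τ) = (leftComb σ).map τ := LTree.map_trans σ τ _

theorem rightComb_eq_map (σ τ : Fin 3 ≃ Fin 3) :
    rightComb (σ.trans τ) = (rightComb σ).map τ := LTree.map_trans σ τ _

theorem leftComb_injective : Function.Injective leftComb := by
  intro σ τ h
  have h' : [σ 0, σ 1, σ 2] = [τ 0, τ 1, τ 2] := congrArg (fun t => t.1.leaves) h
  simp only [List.cons.injEq, and_true] at h'
  ext i : 1
  fin_cases i
  · exact h'.1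
  · exact h'.2.1
  · exact h'.2.2

theorem rightComb_ne_leftComb (σ τ : Fin 3 ≃ Fin 3) : rightComb σ ≠ leftComb τ := by
  intro h
  have := congrArg (fun t => t.1) h
  simp [leftComb, rightComb, LTree.map, PTree.map, PTree.bind] at this

/-- The two left combs of a relator differ by a relabelling and occur with opposite signs, and so do
the two right combs. Orbit sums do not see relabellings. -/
theorem orbitSum_preLieRelator (t : LTree (Fin 3)) {x : TreeMod k (Fin 3)}
    (hx : x ∈ (preLieData k).rel) : orbitSum t x = 0 := by
  have key : ∀ (u : LTree (Fin 3)) (τ : Fin 3 ≃ Fin 3),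
      orbitSum t (Finsupp.single (u.map τ) (1 : k)) = orbitSum t (Finsupp.single u 1) := by
    intro u τ
    rw [← TreeMod.map_single, orbitSum_map_right]
  have hl : ∀ σ, leftComb σ = (leftComb (Equiv.refl _)).map σ := leftComb_eq_map (Equiv.refl _)
  have hr : ∀ σ, rightComb σ = (rightComb (Equiv.refl _)).map σ := rightComb_eq_map (Equiv.refl _)
  induction hx using Submodule.span_induction with
  | zero => simp
  | add x y _ _ hx hy => rw [_root_.map_add, hx, hy, add_zero]
  | smul c x _ hx => rw [_root_.map_smul, hx, smul_zero]
  | mem x hx =>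
    obtain ⟨σ, rfl⟩ := hx
    simp only [preLieRelator, _root_.map_sub]
    rw [hl σ, hr σ, hl (_root_.Equiv.trans _ σ), hr (_root_.Equiv.trans _ σ), key, key, key, key,
      sub_self]

/-- The left combs occur in a relator in pairs that differ by exchanging the last two leaves, with
coefficients `1` and `-1`; right combs are different trees and do not contribute. -/
theorem coeff_preLieRelator (τ : Fin 3 ≃ Fin 3) {x : TreeMod k (Fin 3)}
    (hx : x ∈ (preLieData k).rel) :
    x (leftComb τ) + x (leftComb ((Equiv.swap 1 2).trans τ)) = 0 := by
  classical
  induction hx using Submodule.span_induction with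
  | zero => simp
  | add x y _ _ hx hy =>
    rw [Finsupp.add_apply, Finsupp.add_apply, add_add_add_comm, hx, hy, add_zero]
  | smul c x _ hx => rw [Finsupp.smul_apply, Finsupp.smul_apply, ← smul_add, hx, smul_zero]
  | mem x hx =>
    obtain ⟨σ, rfl⟩ := hx
    have h : (Equiv.swap (1 : Fin 3) 2).trans σ = τ ↔ σ = (Equiv.swap 1 2).trans τ := by
      constructor <;> rintro rfl <;> ext <;> simp
    have h' : (Equiv.swap (1 : Fin 3) 2).trans σ = (Equiv.swap 1 2).trans τ ↔ σ = τ := by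
      constructor
      · intro h
        ext i : 1
        simpa using Equiv.congr_fun h (Equiv.swap 1 2 i)
      · rintro rfl; rfl
    simp only [preLieRelator, Finsupp.sub_apply, Finsupp.single_apply, leftComb_injective.eq_iff,
      rightComb_ne_leftComb, if_false, h, h']
    ring

/-- Transports `coeff_preLieRelator` from `Fin 3` to any label set with three elements. It is needed
for sets of the form `Option A`, where the mark is one of the leaves. -/
theorem exists_swapped_comb [Finite I] (t : LTree I) {p q r : I}
    (ht : t.1 = .node (.node (.leaf p) (.leaf q)) (.leaf r)) :
    ∃ t' : LTree I, t'.1 = .node (.node (.leaf p) (.leaf r)) (.leaf q) ∧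
      ∀ x ∈ (preLieData k).koszulDual.carrier I, x t + x t' = 0 := by
  obtain ⟨hn, hm⟩ := t.2
  simp only [ht, PTree.leaves] at hn hm
  simp at hn hm
  let e : Fin 3 ≃ I := Equiv.ofBijective ![p, q, r] (by
    constructor
    · intro i j h
      fin_cases i <;> fin_cases j <;> simp_all
    · intro i
      rcases hm i with rfl | rfl | rfl
      exacts [⟨0, rfl⟩, ⟨1, rfl⟩, ⟨2, rfl⟩])
  have h1 : t = (leftComb (Equiv.refl _)).map e := by
    apply Subtype.ext
    rw [ht]
    rfl
  refine ⟨(leftComb ((Equiv.swap 1 2).trans (Equiv.refl _))).map e, rfl, fun x hx => ?_⟩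
  have := coeff_preLieRelator (Equiv.refl _) (koszulDual_carrier_le _
    ((preLieData k).koszulDual.map_mem e.symm x hx))
  rw [← TreeMod.map_apply e, ← TreeMod.map_apply e, ← h1] at this
  have h2 : TreeMod.map k e (TreeMod.map k e.symm x) = x := by
    have h3 : TreeMod.map k (e.symm.trans e) x = _ := (FreeOp k).map_trans e.symm e x
    have h4 : TreeMod.map k (Equiv.refl I) x = x := (FreeOp k).map_refl x
    rw [Equiv.symm_trans_self, h4] at h3
    exact h3.symm
  rwa [h2] at this

theorem orbitSum_eq_zero_of_equiv [Finite I] [Finite J] (C : Subcooperad k) (e : I ≃ J)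
    (t : LTree I) (h : ∀ x ∈ C.carrier I, orbitSum t x = 0) :
    ∀ x ∈ C.carrier J, orbitSum (t.map e) x = 0 := by
  intro x hx
  rw [← orbitSum_map_map _ e.symm x, ← LTree.map_trans, Equiv.self_trans_symm, LTree.map_refl]
  exact h _ (C.map_mem e.symm x hx)

/-- The components of the Koszul dual cooperad of `PL` of arity at least three have no
non-zero invariants. -/
theorem orbitSum_koszulDual [CharZero k] (n : ℕ) (hn : 3 ≤ n) :
    ∀ (I : Type) [Finite I], Nat.card I = n → ∀ (t : LTree I),
      ∀ x ∈ (preLieData k).koszulDual.carrier I, orbitSum t x = 0 := by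
  induction n using Nat.strong_induction_on with
  | _ n ih =>
  intro I _ hI t
  -- The case of a large left subtree is stated for all label sets of size `n`, as it is used again
  -- below for a different tree, labelled by `A ⊕ B`.
  have left : ∀ (I : Type) [Finite I], Nat.card I = n → ∀ (t : LTree I) (l r : PTree I),
      t.1 = .node l r → 3 ≤ l.leaves.length →
      ∀ x ∈ (preLieData k).koszulDual.carrier I, orbitSum t x = 0 := by
    intro I _ hI t l r ht hl
    obtain ⟨A, B, _, _, e, a, b, hab, hB⟩ := t.exists_graft_left ht
    have h1 := t.length_leaves
    have h2 := r.length_leaves_pos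
    rw [ht, PTree.leaves, List.length_append] at h1
    rw [← hab]
    exact orbitSum_eq_zero_of_equiv _ e _
      (Subcooperad.orbitSum_graft_eq_zero _ a b (ih _ (by omega) (by omega) B rfl b))
  rcases hn.eq_or_lt with rfl | hn'
  · intro x hx
    let e : I ≃ Fin 3 := Finite.equivFinOfCardEq hI
    rw [← orbitSum_map_map t e]
    exact orbitSum_preLieRelator _
      (koszulDual_carrier_le _ ((preLieData k).koszulDual.map_mem e x hx))
  have h1 := t.length_leaves
  rcases ht : t.1 with i | ⟨l, r⟩
  · rw [ht, PTree.leaves, List.length_singleton] at h1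
    omega
  by_cases hl : 3 ≤ l.leaves.length
  · exact left I hI t l r ht hl
  rw [ht, PTree.leaves, List.length_append] at h1
  have hlpos := l.length_leaves_pos
  obtain ⟨A, B, _, _, e, a, b, hab, hB, a', ha⟩ := t.exists_graft_right ht
  rw [← hab]
  apply orbitSum_eq_zero_of_equiv
  by_cases hr : 3 ≤ r.leaves.length
  · exact Subcooperad.orbitSum_graft_eq_zero _ a b (ih _ (by omega) (by omega) B rfl b)
  have hA : Nat.card (A ⊕ B) = n := (Nat.card_congr e).trans hI
  have hA' := hA
  rw [Nat.card_sum] at hA'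
  have h2 := a.length_leaves
  rw [Finite.card_option, ha, PTree.leaves, List.length_append, PTree.leaves_map,
    List.length_map, PTree.leaves, List.length_singleton] at h2
  -- Both subtrees have at most two leaves and `n ≥ 4`, so each has exactly two, and `a` is `(p q)
  -- *`.
  obtain ⟨p, q, rfl⟩ := PTree.exists_eq_node (t := a') (by omega)
  obtain ⟨a'', ha'', h⟩ := exists_swapped_comb (k := k) a ha
  -- After the exchange the lower tree is `(p *) q`; grafting `b` at the mark gives a left subtree
  -- with `1 + 2` leaves.
  have h3 : ∀ x ∈ (preLieData k).koszulDual.carrier (A ⊕ B), orbitSum (a''.graft b) x = 0 := by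
    refine left (A ⊕ B) hA _ (.node (.leaf (Sum.inl p)) (b.1.map Sum.inr)) (.leaf (Sum.inl q))
      ?_ ?_
    · change a''.1.graft b.1 = _
      rw [ha'']
      rfl
    · rw [PTree.leaves, List.length_append, PTree.leaves_map, List.length_map, b.length_leaves,
        PTree.leaves, List.length_singleton]
      omega
  intro x hx
  -- The relation in the lower factor is paired with the coefficient of `b` in the upper one. The
  -- signs need not be evaluated: the second orbit sum is zero, and the first has an invertible
  -- coefficient.
  have h4 := Subcooperad.orbitSum_eq_zero_of_coeff (preLieData k).koszulDual
    (t := a.graft b) (t' := a''.graft b)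
    ((-1) ^ (a.1.afterMark * b.1.vertices)) ((-1) ^ (a''.1.afterMark * b.1.vertices))
    (fun x hx => by
      rw [← TreeMod.coeff_decomp, ← TreeMod.coeff_decomp, ← _root_.map_add, ← LinearMap.add_apply,
        ← TensorProduct.map_add_left]
      exact Subcooperad.map_decomp_eq_zero _ _ _ (.inl h) hx) x hx
  rw [h3 x hx, mul_zero, add_zero] at h4
  exact (mul_eq_zero.mp h4).resolve_left (pow_ne_zero _ (neg_ne_zero.mpr one_ne_zero))

end KoszulDual
-- Arities one and two of the Koszul dual cooperad.
section SmallArities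

variable {k : Type u} [Field k]

theorem LTree.card_pos {I : Type} (t : LTree I) : 0 < Nat.card I :=
  t.length_leaves ▸ t.1.length_leaves_pos

variable (k) in
/-- The subcooperad of `𝒯ᶜ(sX)` of all elements of arity at most two. -/
noncomputable def truncation : Subcooperad k where
  carrier I _ := if Nat.card I ≤ 2 then ⊤ else ⊥
  map_mem {I J} _ _ e x hx := by
    rw [← Nat.card_congr e]
    split_ifs at hx ⊢ with h
    · trivial
    · rw [(Submodule.mem_bot k).mp hx, _root_.map_zero]
      exact Submodule.zero_mem _
  decomp_mem {A B} _ _ x hx := by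
    by_cases h : Nat.card (A ⊕ B) ≤ 2
    · clear hx
      induction x using Finsupp.induction_linear with
      | zero => rw [_root_.map_zero]; exact Submodule.zero_mem _
      | add x y hx hy => rw [_root_.map_add]; exact Submodule.add_mem _ hx hy
      | single t c =>
        rw [← mul_one c, ← smul_eq_mul, ← Finsupp.smul_single, _root_.map_smul]
        apply Submodule.smul_mem
        by_cases hp : ∃ p : LTree (Option A) × LTree B, p.1.graft p.2 = t
        · obtain ⟨⟨a, b⟩, rfl⟩ := hp
          rw [TreeMod.decomp_graft]
          apply Submodule.smul_mem
          -- The upper tree has at least one leaf, so `A` has at most one element and `Option A` at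
          -- most two.
          have hb := b.card_pos
          rw [Nat.card_sum] at h
          have hA : Nat.card (Option A) ≤ 2 := by rw [Finite.card_option]; omega
          have hB : Nat.card B ≤ 2 := by omega
          exact ⟨⟨Finsupp.single a 1, by rw [if_pos hA]; trivial⟩ ⊗ₜ
            ⟨Finsupp.single b 1, by rw [if_pos hB]; trivial⟩, TensorProduct.map_tmul ..⟩
        · rw [TreeMod.decomp_of_not k t hp]
          exact Submodule.zero_mem _
    · rw [if_neg h] at hx
      rw [(Submodule.mem_bot k).mp hx, _root_.map_zero]
      exact Submodule.zero_mem _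

/-- The truncation is zero in arity three, so it satisfies every quadratic condition and is
contained in the largest such subcooperad. -/
theorem mem_koszulDual (R : QuadraticData k) {I : Type} [Finite I] (h : Nat.card I ≤ 2)
    (x : TreeMod k I) : x ∈ R.koszulDual.carrier I := by
  refine Submodule.mem_iSup_of_mem
    (p := fun D : {D : Subcooperad k // D.carrier (Fin 3) ≤ R.rel} => D.1.carrier I)
    ⟨truncation k, ?_⟩ ?_
  · change (if Nat.card (Fin 3) ≤ 2 then ⊤ else ⊥) ≤ _
    rw [if_neg (by simp)]
    exact bot_le
  · change x ∈ (if Nat.card I ≤ 2 then ⊤ else ⊥ : Submodule k _)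
    rw [if_pos h]
    trivial

/-- The corolla with one input. -/
def tree₁ : LTree (Fin 1) :=
  ⟨.leaf 0, by simp [PTree.leaves], fun i => by simp [PTree.leaves, Subsingleton.elim i 0]⟩

/-- The corolla with two inputs. -/
def tree₂ : LTree (Fin 2) :=
  ⟨.node (.leaf 0) (.leaf 1), by simp [PTree.leaves], by simp [PTree.leaves, Fin.forall_fin_succ]⟩

/-- Transitivity on trees is what makes an equivariant map in this arity depend on a single scalar;
the same holds in arity two. -/
theorem tree₁_transitive {I : Type} (t : LTree I) (h : Nat.card I = 1) :
    ∃ e : Fin 1 ≃ I, tree₁.map e = t := by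
  obtain ⟨i, hi⟩ := PTree.exists_eq_leaf (t := t.1) (t.length_leaves.trans h)
  have hm := t.2.2
  simp only [hi, PTree.leaves, List.mem_singleton] at hm
  refine ⟨⟨fun _ => i, fun _ => 0, fun _ => Subsingleton.elim _ _, fun j => (hm j).symm⟩,
    Subtype.ext ?_⟩
  rw [hi]
  rfl

theorem tree₂_transitive {I : Type} (t : LTree I) (h : Nat.card I = 2) :
    ∃ e : Fin 2 ≃ I, tree₂.map e = t := by
  obtain ⟨i, j, hij⟩ := PTree.exists_eq_node (t := t.1) (t.length_leaves.trans h)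
  obtain ⟨hn, hm⟩ := t.2
  simp only [hij, PTree.leaves] at hn hm
  simp at hn hm
  refine ⟨Equiv.ofBijective ![i, j] ⟨?_, ?_⟩, Subtype.ext ?_⟩
  · intro p q hpq
    fin_cases p <;> fin_cases q <;> simp_all
  · intro l
    rcases hm l with rfl | rfl
    exacts [⟨0, rfl⟩, ⟨1, rfl⟩]
  · exact hij.symm

end SmallArities

/-! ### Values in `Com`, and decompositions with a trivial factor. -/

section ComValues

variable {k : Type u} [Field k] {I J A B : Type} [Finite I] [Finite J] [Finite A] [Finite B]

variable (k I) in
/-- The inclusion `Com(I) → k`. -/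
def comVal : (Com k).obj I →ₗ[k] k := Submodule.subtype _

theorem comVal_injective : Function.Injective (comVal k I) := Subtype.val_injective

theorem comVal_map (e : I ≃ J) (x : (Com k).obj I) :
    comVal k J ((Com k).map e x) = comVal k I x := rfl

theorem comVal_comp (x : (Com k).obj (Option A)) (y : (Com k).obj B) :
    comVal k (A ⊕ B) ((Com k).comp x y) = comVal k (Option A) x * comVal k B y := rfl

theorem augmentation_decomp_graft {A B : Type} (a : LTree (Option A)) (b : LTree B) :
    LinearMap.mul' k k (TensorProduct.map (augmentation k _) (augmentation k _)
      (TreeMod.decomp k (Finsupp.single (a.graft b) 1))) =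
        (-1) ^ (a.1.afterMark * b.1.vertices) := by
  rw [TreeMod.decomp_graft, _root_.map_smul, _root_.map_smul, TensorProduct.map_tmul,
    LinearMap.mul'_apply, augmentation_single, augmentation_single, mul_one, smul_eq_mul, mul_one]

/-- Every leaf can be cut off as a one-leaf tree. That tree has no vertices, so the sign is trivial.
-/
theorem augmentation_decomp_of_card_right {A : Type} (t : LTree (A ⊕ B)) (h : Nat.card B = 1) :
    LinearMap.mul' k k (TensorProduct.map (augmentation k _) (augmentation k _)
      (TreeMod.decomp k (Finsupp.single t 1))) = 1 := by
  let τ : B ≃ Unit := (Finite.equivFinOfCardEq h).trans finOneEquiv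
  obtain ⟨a, ha⟩ : ∃ a : LTree (Option A), (a.graft LTree.one).map
      (Equiv.sumCongr (Equiv.refl A) τ.symm) = t := by
    refine ⟨(t.map (Equiv.sumCongr (Equiv.refl A) τ)).map (Equiv.optionEquivSumPUnit A).symm, ?_⟩
    rw [LTree.graft_one, ← LTree.map_trans, ← LTree.map_trans, ← LTree.map_trans]
    convert LTree.map_refl t
    ext (x | x)
    · simp
    · simp [Subsingleton.elim _ (τ x)]
  rw [← ha, ← LTree.graft_map, Equiv.optionCongr_refl, LTree.map_refl, augmentation_decomp_graft]
  have := (LTree.one.map τ.symm).vertices_add_one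
  rw [h, Nat.add_eq_right] at this
  rw [this, mul_zero, pow_zero]

/-- With `A` empty, the lower factor is the one-leaf tree below the root. No vertex follows its
mark, so again there is no sign. -/
theorem augmentation_decomp_of_card_left {B : Type} (t : LTree (A ⊕ B)) (h : Nat.card A = 0) :
    LinearMap.mul' k k (TensorProduct.map (augmentation k _) (augmentation k _)
      (TreeMod.decomp k (Finsupp.single t 1))) = 1 := by
  have : IsEmpty A := Finite.card_eq_zero_iff.mp h
  let σ : A ≃ Empty := Equiv.equivOfIsEmpty _ _
  obtain ⟨b, hb⟩ : ∃ b : LTree B, ((LTree.one.map (Equiv.ofUnique Unit (Option Empty))).graft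
      b).map (Equiv.sumCongr σ.symm (Equiv.refl B)) = t := by
    refine ⟨t.map (Equiv.emptySum A B), ?_⟩
    rw [LTree.one_graft, ← LTree.map_trans, ← LTree.map_trans]
    convert LTree.map_refl t
    ext (x | x)
    · exact isEmptyElim x
    · simp
  rw [← hb, ← LTree.graft_map, augmentation_decomp_graft, LTree.map_refl]
  change (-1 : k) ^ (0 * _) = 1
  rw [zero_mul, pow_zero]

end ComValues

/-! ### The convolution product on the elements `arityProj`. -/

section Convolution

variable {k : Type u} [Field k] (C : Subcooperad k)

open Classical in
/-- The element of the convolution algebra that sends every tree with `m` leaves to `1` and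
vanishes in all other arities. -/
noncomputable def arityProj (m : ℕ) : Conv C (Com k) :=
  ⟨fun I => if Nat.card I.1 = m then
      (freeToCom k).app I.1 ∘ₗ (C.carrier I.1).subtype else 0, by
    intro I J e x
    by_cases h : Nat.card I.1 = m
    · have h' : Nat.card J.1 = m := (Nat.card_congr e).symm.trans h
      simp only [if_pos h, if_pos h']
      exact (freeToCom k).app_map e x.1
    · have h' : Nat.card J.1 ≠ m := fun h' => h ((Nat.card_congr e).trans h')
      simp [if_neg h, if_neg h']⟩

variable {C}

theorem comVal_arityProj {m : ℕ} {I : FinType} (h : Nat.card I.1 = m) (x : C.carrier I.1) :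
    comVal k I.1 ((arityProj C m).1 I x) = augmentation k I.1 x.1 := by
  simp only [arityProj, if_pos h]
  rfl

theorem arityProj_of_ne {m : ℕ} {I : FinType} (h : Nat.card I.1 ≠ m) :
    (arityProj C m).1 I = 0 := if_neg h

theorem arityProj_mem (m : ℕ) : arityProj C m ∈ Conv.degree C (Com k) (1 - m) := fun I h =>
  arityProj_of_ne fun h' => h (by rw [arityDegree, h']; ring)

theorem mcElement_projPLCom :
    mcElement (projPLCom k) = arityProj (preLieData k).koszulDual 2 := by
  apply Subtype.ext
  funext I
  by_cases h : Nat.card I.1 = 2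
  · simp only [mcElement, arityProj, if_pos h]
    rfl
  · simp only [mcElement, arityProj, if_neg h]

/-- The arities of the two factors add up to that of `I` plus one, so their degrees add up; in a
wrong arity one of `φ` and `ψ` is evaluated outside its support. -/
theorem convTerm_eq_zero {Q : Operad k} {p q : ℤ} {φ ψ : Conv C Q}
    (hφ : φ ∈ Conv.degree C Q p) (hψ : ψ ∈ Conv.degree C Q q) (I : FinType)
    (hI : -arityDegree I.1 ≠ p + q) (J : Set I.1) : convTerm φ.1 ψ.1 I J = 0 := by
  by_cases hp : -arityDegree (Option {i // i ∉ J}) = p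
  · have hq : ψ.1 (fin {i // i ∈ J}) = 0 := by
      refine hψ _ fun hq => hI ?_
      have h := Nat.card_congr (splitEquiv J)
      rw [Nat.card_sum] at h
      rw [← hp, ← hq, arityDegree, arityDegree, arityDegree, Finite.card_option, h]
      push_cast
      ring
    simp [convTerm, hq]
  · have hp' : φ.1 (fin (Option {i // i ∉ J})) = 0 := hφ _ hp
    simp [convTerm, hp']

theorem preLie_mem {Q : Operad k} {p q : ℤ} {φ ψ : Conv C Q}
    (hφ : φ ∈ Conv.degree C Q p) (hψ : ψ ∈ Conv.degree C Q q) :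
    preLie φ ψ ∈ Conv.degree C Q (p + q) := fun I hI =>
  Finset.sum_eq_zero fun J _ => convTerm_eq_zero hφ hψ I hI J

theorem bracket_mem {Q : Operad k} {p q : ℤ} {φ ψ : Conv C Q}
    (hφ : φ ∈ Conv.degree C Q p) (hψ : ψ ∈ Conv.degree C Q q) :
    bracket p q φ ψ ∈ Conv.degree C Q (p + q) := by
  refine Submodule.sub_mem _ (preLie_mem hφ hψ) ?_
  rw [Units.smul_def]
  exact zsmul_mem (add_comm q p ▸ preLie_mem hψ hφ) _

/-- The Koszul sign has exponent `(n - 1)(m - 1)`, which is zero under `hs`. -/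
theorem comVal_convTerm (m n : ℕ) (I : FinType) (J : Set I.1) (x : C.carrier I.1)
    (hm : Nat.card (Option {i // i ∉ J}) = m) (hn : Nat.card {i // i ∈ J} = n)
    (hs : m = 1 ∨ n = 1) :
    comVal k I.1 (convTerm (arityProj C m).1 (arityProj C n).1 I J x) =
      LinearMap.mul' k k (TensorProduct.map (augmentation k _) (augmentation k _)
        (TreeMod.decomp k (TreeMod.map k (splitEquiv J) x.1))) := by
  have h1 : arityDegree {i // i ∈ J} * arityDegree (Option {i // i ∉ J}) = 0 := by
    rw [arityDegree, arityDegree, hm, hn]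
    rcases hs with rfl | rfl <;> simp
  have h2 : ∀ z : C.carrier (Option {i // i ∉ J}) ⊗[k] C.carrier {i // i ∈ J},
      comVal k _ (TensorProduct.lift (Com k).comp
        (TensorProduct.map ((arityProj C m).1 (fin (Option {i // i ∉ J})))
          ((arityProj C n).1 (fin {i // i ∈ J})) z)) =
      LinearMap.mul' k k (TensorProduct.map (augmentation k _) (augmentation k _)
        (TensorProduct.map (C.carrier _).subtype (C.carrier _).subtype z)) := by
    intro z
    induction z with
    | zero => simp only [_root_.map_zero]
    | add z w hz hw => simp only [_root_.map_add, hz, hw]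
    | tmul y y' =>
      rw [TensorProduct.map_tmul, TensorProduct.lift.tmul, comVal_comp, TensorProduct.map_tmul,
        TensorProduct.map_tmul, LinearMap.mul'_apply]
      exact congrArg₂ (· * ·) (comVal_arityProj (I := fin _) hm y)
        (comVal_arityProj (I := fin _) hn y')
  rw [convTerm, h1, Int.negOnePow_zero, one_smul]
  simp only [LinearMap.comp_apply, comVal_map]
  rw [h2, C.decomp_spec]
  rfl

theorem card_compl_add (I : FinType) (J : Set I.1) :
    Nat.card {i // i ∉ J} + Nat.card {i // i ∈ J} = Nat.card I.1 := by
  rw [← Nat.card_sum]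
  exact (Nat.card_congr (splitEquiv J)).symm

theorem sum_card_eq_ite (m : ℕ) [Fintype (Set (Fin 2))] :
    (∑ J : Set (Fin 2), if Nat.card {i // i ∈ J} = m then (1 : k) else 0) = Nat.choose 2 m := by
  classical
  rw [← Fintype.sum_equiv (Fintype.finsetEquivSet (α := Fin 2))
    (fun s => if s.card = m then (1 : k) else 0) _ (fun s => by simp)]
  rw [Finset.sum_boole, Finset.univ_filter_card_eq]
  simp

/-- The two singletons `J` contribute `1` each: the identity is inserted at either input of the
vertex. -/
theorem comVal_preLie_two_one (x : C.carrier (Fin 2)) (hx : x.1 = Finsupp.single tree₂ 1) :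
    comVal k (Fin 2) ((preLie (arityProj C 2) (arityProj C 1)).1 (fin (Fin 2)) x) = 2 := by
  let _ : Fintype (Set (Fin 2)) := Fintype.ofFinite _
  have h : (preLie (arityProj C 2) (arityProj C 1)).1 (fin (Fin 2)) =
    ∑ J : Set (Fin 2), convTerm (arityProj C 2).1 (arityProj C 1).1 (fin (Fin 2)) J := rfl
  rw [h, LinearMap.sum_apply, _root_.map_sum]
  refine Eq.trans (Finset.sum_congr rfl fun J _ => ?_) ((sum_card_eq_ite 1).trans (by simp))
  have hJ : Nat.card {i // i ∉ J} + Nat.card {i // i ∈ J} = 2 :=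
    (card_compl_add (fin (Fin 2)) J).trans (Nat.card_fin 2)
  have hA := Finite.card_option (α := {i // i ∉ J})
  split_ifs with h1
  · rw [comVal_convTerm 2 1 (fin (Fin 2)) J x (hA.trans (by omega)) h1 (.inr rfl), hx,
      TreeMod.map_single, augmentation_decomp_of_card_right _ h1]
  · have h2 : (arityProj C 1).1 (fin {i // i ∈ J}) = 0 := arityProj_of_ne h1
    simp [convTerm, h2]

/-- Only `J = univ` contributes: the vertex is placed above the identity. -/
theorem comVal_preLie_one_two (x : C.carrier (Fin 2)) (hx : x.1 = Finsupp.single tree₂ 1) :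
    comVal k (Fin 2) ((preLie (arityProj C 1) (arityProj C 2)).1 (fin (Fin 2)) x) = 1 := by
  let _ : Fintype (Set (Fin 2)) := Fintype.ofFinite _
  have h : (preLie (arityProj C 1) (arityProj C 2)).1 (fin (Fin 2)) =
    ∑ J : Set (Fin 2), convTerm (arityProj C 1).1 (arityProj C 2).1 (fin (Fin 2)) J := rfl
  rw [h, LinearMap.sum_apply, _root_.map_sum]
  refine Eq.trans (Finset.sum_congr rfl fun J _ => ?_) ((sum_card_eq_ite 2).trans (by simp))
  have hJ : Nat.card {i // i ∉ J} + Nat.card {i // i ∈ J} = 2 :=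
    (card_compl_add (fin (Fin 2)) J).trans (Nat.card_fin 2)
  have hA := Finite.card_option (α := {i // i ∉ J})
  split_ifs with h1
  · have h0 : Nat.card {i // i ∉ J} = 0 := by omega
    rw [comVal_convTerm 1 2 (fin (Fin 2)) J x (hA.trans (by omega)) h1 (.inl rfl), hx,
      TreeMod.map_single, augmentation_decomp_of_card_left _ h0]
  · have h2 : (arityProj C 2).1 (fin {i // i ∈ J}) = 0 := arityProj_of_ne h1
    simp [convTerm, h2]

end Convolution

/-! ### The deformation complex of the projection to `Com`. -/

section Deformation

variable {k : Type u} [Field k]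

/-- All coefficients of the symmetrization of `x` are orbit sums, hence zero. By equivariance and
triviality of the action on `Com`, `φ` sends it to the order of the group times `φ(x)`. -/
theorem conv_apply_eq_zero [CharZero k] (φ : Conv (preLieData k).koszulDual (Com k))
    (I : FinType) (hI : 3 ≤ Nat.card I.1) : φ.1 I = 0 := by
  refine LinearMap.ext fun x => comVal_injective ?_
  let _ : Fintype (I.1 ≃ I.1) := Fintype.ofFinite _
  have h1 : ∑ σ : I.1 ≃ I.1, (preLieData k).koszulDual.map σ x = 0 := by
    apply Subtype.ext
    refine Finsupp.ext fun t => ?_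
    have h := orbitSum_koszulDual _ hI I.1 rfl t x.1 x.2
    rw [orbitSum_apply] at h
    rw [AddSubmonoidClass.coe_finsetSum, Finsupp.finsetSum_apply]
    refine Eq.trans ?_ h
    -- Acting by `σ` on an element moves the coefficients by the inverse of `σ`.
    refine Fintype.sum_equiv ⟨Equiv.symm, Equiv.symm, fun _ => rfl, fun _ => rfl⟩ _ _ fun σ => ?_
    change TreeMod.map k σ x.1 t = x.1 (t.map σ.symm)
    rw [← TreeMod.map_apply σ x.1, ← LTree.map_trans, Equiv.symm_trans_self, LTree.map_refl]
  have h2 := congrArg (comVal k I.1 ∘ₗ φ.1 I) h1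
  simp only [_root_.map_sum, LinearMap.comp_apply, φ.2 I I, comVal_map, Finset.sum_const,
    _root_.map_zero, nsmul_eq_mul] at h2
  rw [LinearMap.zero_apply, _root_.map_zero]
  refine (mul_eq_zero.mp h2).resolve_left ?_
  rw [Finset.card_univ]
  exact Nat.cast_ne_zero.mpr Fintype.card_ne_zero

theorem degree_eq_bot [CharZero k] (j : ℤ) (h0 : j ≠ 0) (h1 : j ≠ -1) :
    Conv.degree (preLieData k).koszulDual (Com k) j = ⊥ := by
  rw [eq_bot_iff]
  intro φ hφ
  refine (Submodule.mem_bot k).mpr (Subtype.ext (funext fun I => ?_))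
  by_cases hj : -arityDegree I.1 = j
  · rcases Nat.lt_or_ge (Nat.card I.1) 3 with h | h
    · have h2 : Nat.card I.1 = 0 := by
        rw [arityDegree] at hj
        omega
      have : IsEmpty I.1 := Finite.card_eq_zero_iff.mp h2
      exact LinearMap.ext fun x => Subtype.ext ((φ.1 I x).2 this)
    · exact conv_apply_eq_zero φ I h
  · exact hφ I hj

/-- The scalar is the value at `t₀`. By transitivity and equivariance all other trees take the same
value. -/
theorem exists_eq_smul_arityProj {m : ℕ} (hm : m ≤ 2) (t₀ : LTree (Fin m))
    (ht : ∀ {I : Type} (t : LTree I), Nat.card I = m → ∃ e : Fin m ≃ I, t₀.map e = t)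
    (R : QuadraticData k) {φ : Conv R.koszulDual (Com k)}
    (hφ : φ ∈ Conv.degree R.koszulDual (Com k) (1 - m)) :
    ∃ c : k, c • arityProj R.koszulDual m = φ := by
  have hc : Nat.card (Fin m) = m := Nat.card_fin m
  let x₀ : R.koszulDual.carrier (Fin m) :=
    ⟨Finsupp.single t₀ 1, mem_koszulDual R (hc.le.trans hm) _⟩
  let c : k := comVal k (Fin m) (φ.1 (fin (Fin m)) x₀)
  refine ⟨c, Subtype.ext (funext fun I => ?_)⟩
  by_cases hI : Nat.card I.1 = m
  · have key : ∀ (y : TreeMod k I.1) (hy : y ∈ R.koszulDual.carrier I.1),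
        c * augmentation k I.1 y = comVal k I.1 (φ.1 I ⟨y, hy⟩) := by
      have hmem := mem_koszulDual R (hI.le.trans hm)
      intro y hy
      induction y using Finsupp.induction_linear with
      | zero =>
        rw [_root_.map_zero, mul_zero]
        exact ((congrArg _ (_root_.map_zero _)).trans (_root_.map_zero _)).symm
      | add y z h h' =>
        rw [_root_.map_add, mul_add, h (hmem y), h' (hmem z), ← _root_.map_add, ← _root_.map_add]
        rfl
      | single t d =>
        obtain ⟨e, rfl⟩ := ht t hI
        have h1 : (⟨Finsupp.single (t₀.map e) d, hy⟩ : R.koszulDual.carrier I.1) =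
            d • R.koszulDual.map e x₀ := by
          apply Subtype.ext
          change _ = d • TreeMod.map k e (Finsupp.single t₀ 1)
          rw [TreeMod.map_single, Finsupp.smul_single, smul_eq_mul, mul_one]
        rw [h1, _root_.map_smul, _root_.map_smul, augmentation_single,
          φ.2 (fin (Fin m)) I e x₀, comVal_map, smul_eq_mul, mul_comm]
    refine LinearMap.ext fun x => comVal_injective ?_
    rw [← key x.1 x.2, ← comVal_arityProj hI x]
    rfl
  · rw [hφ I fun h => hI (by rw [arityDegree] at h; omega)]
    change c • (arityProj R.koszulDual m).1 I = 0
    rw [arityProj_of_ne hI, smul_zero]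

theorem exists_comVal_arityProj_ne_zero {m : ℕ} (hm : m ≤ 2) (t₀ : LTree (Fin m))
    (R : QuadraticData k) : ∃ x : R.koszulDual.carrier (Fin m), x.1 = Finsupp.single t₀ 1 ∧
      comVal k (Fin m) ((arityProj R.koszulDual m).1 (fin (Fin m)) x) = 1 := by
  have hc : Nat.card (Fin m) = m := Nat.card_fin m
  refine ⟨⟨Finsupp.single t₀ 1, mem_koszulDual R (hc.le.trans hm) _⟩, rfl, ?_⟩
  rw [comVal_arityProj (I := fin (Fin m)) hc, augmentation_single]

theorem arityProj_ne_zero {m : ℕ} (hm : m ≤ 2) (t₀ : LTree (Fin m)) (R : QuadraticData k) :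
    arityProj R.koszulDual m ≠ 0 := by
  intro h
  obtain ⟨x, -, hx⟩ := exists_comVal_arityProj_ne_zero hm t₀ R
  rw [h] at hx
  exact zero_ne_one ((_root_.map_zero (comVal k (Fin m))).symm.trans hx)

theorem defDifferential_projPLCom (j : ℤ) (φ : Conv (preLieData k).koszulDual (Com k)) :
    defDifferential (projPLCom k) j φ =
      bracket (-1) j (arityProj (preLieData k).koszulDual 2) φ := by
  rw [← mcElement_projPLCom]
  rfl

/-- For degree reasons the result is a multiple of `arityProj 2`, and its value at one binary tree
fixes the factor. The bracket has sign `(-1)^{(-1)·0} = 1`, so the value is `2 - 1`. -/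
theorem defDifferential_arityProj :
    defDifferential (projPLCom k) 0 (arityProj (preLieData k).koszulDual 1) =
      arityProj (preLieData k).koszulDual 2 := by
  have hmem : defDifferential (projPLCom k) 0 (arityProj (preLieData k).koszulDual 1) ∈
      Conv.degree (preLieData k).koszulDual (Com k) (1 - (2 : ℕ)) := by
    rw [defDifferential_projPLCom]
    have h := bracket_mem (arityProj_mem (C := (preLieData k).koszulDual) 2)
      (arityProj_mem (C := (preLieData k).koszulDual) 1)
    simpa using h
  obtain ⟨c, hc⟩ := exists_eq_smul_arityProj le_rfl tree₂ tree₂_transitive _ hmem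
  obtain ⟨x, hx, hx'⟩ := exists_comVal_arityProj_ne_zero le_rfl tree₂ (preLieData k)
  have h1 : comVal k (Fin 2) ((c • arityProj (preLieData k).koszulDual 2).1 (fin (Fin 2)) x) =
      c * 1 := by
    rw [← hx']
    rfl
  have h2 : comVal k (Fin 2) ((defDifferential (projPLCom k) 0
      (arityProj (preLieData k).koszulDual 1)).1 (fin (Fin 2)) x) = 2 - 1 := by
    rw [defDifferential_projPLCom, ← comVal_preLie_two_one x hx,
      ← comVal_preLie_one_two x hx, ← _root_.map_sub]
    simp [bracket]
  rw [← hc, h1] at h2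
  rw [← hc, show c = 1 by linear_combination h2, one_smul]

theorem mem_defDegree_zero {φ : Conv (preLieData k).koszulDual (Com k)} :
    φ ∈ defDegree (projPLCom k) 0 ↔ ∃ c : k, c • arityProj (preLieData k).koszulDual 1 = φ := by
  constructor
  · intro h
    exact exists_eq_smul_arityProj one_le_two tree₁ tree₁_transitive _ (by simpa using h)
  · rintro ⟨c, rfl⟩
    exact Submodule.smul_mem _ c (by simpa using arityProj_mem (C := (preLieData k).koszulDual) 1)

theorem mem_defDegree_neg_one {φ : Conv (preLieData k).koszulDual (Com k)} :
    φ ∈ defDegree (projPLCom k) (-1) ↔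
      ∃ c : k, c • arityProj (preLieData k).koszulDual 2 = φ := by
  constructor
  · intro h
    exact exists_eq_smul_arityProj le_rfl tree₂ tree₂_transitive _ (by simpa using h)
  · rintro ⟨c, rfl⟩
    exact Submodule.smul_mem _ c (by simpa using arityProj_mem (C := (preLieData k).koszulDual) 2)

theorem bijOn_defDifferential :
    Set.BijOn (defDifferential (projPLCom k) 0) (defDegree (projPLCom k) 0)
      (defDegree (projPLCom k) (-1)) := by
  refine ⟨?_, ?_, ?_⟩
  · intro φ hφ
    obtain ⟨c, rfl⟩ := mem_defDegree_zero.mp hφ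
    rw [_root_.map_smul, defDifferential_arityProj]
    exact mem_defDegree_neg_one.mpr ⟨c, rfl⟩
  · intro φ hφ ψ hψ h
    obtain ⟨c, rfl⟩ := mem_defDegree_zero.mp hφ
    obtain ⟨d, rfl⟩ := mem_defDegree_zero.mp hψ
    rw [_root_.map_smul, _root_.map_smul, defDifferential_arityProj] at h
    rw [smul_left_injective k (arityProj_ne_zero le_rfl tree₂ _) h]
  · intro φ hφ
    obtain ⟨c, rfl⟩ := mem_defDegree_neg_one.mp hφ
    refine ⟨_, mem_defDegree_zero.mpr ⟨c, rfl⟩, ?_⟩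
    rw [_root_.map_smul, defDifferential_arityProj]

theorem finrank_degree_zero :
    Module.finrank k (Conv.degree (preLieData k).koszulDual (Com k) 0) = 1 := by
  let v : Conv.degree (preLieData k).koszulDual (Com k) 0 :=
    ⟨arityProj _ 1, mem_defDegree_zero.mpr ⟨1, one_smul _ _⟩⟩
  refine finrank_eq_one v (fun h =>
    arityProj_ne_zero one_le_two tree₁ _ (congrArg Subtype.val h)) fun φ => ?_
  obtain ⟨c, hc⟩ := mem_defDegree_zero.mp φ.2
  exact ⟨c, Subtype.ext hc⟩

theorem defDifferential_mem {j : ℤ} {φ : Conv (preLieData k).koszulDual (Com k)}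
    (hφ : φ ∈ defDegree (projPLCom k) j) :
    defDifferential (projPLCom k) j φ ∈ defDegree (projPLCom k) (-1 + j) :=
  bracket_mem (mem_defDegree_neg_one.mpr ⟨1, by rw [one_smul, mcElement_projPLCom]⟩) hφ

/-- Formal from the bijection between degrees `0` and `-1` and the vanishing of all others; no
separate check that the differential squares to zero is needed. -/
theorem deformationAcyclic_projPLCom [CharZero k] : DeformationAcyclic (projPLCom k) := by
  have hbot : ∀ j : ℤ, j ≠ 0 → j ≠ -1 → defDegree (projPLCom k) j = ⊥ := degree_eq_bot
  intro j
  by_cases h0 : j = 0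
  · subst h0
    rw [hbot (0 + 1) (by norm_num) (by norm_num), Submodule.map_bot, eq_bot_iff]
    rintro φ ⟨h1, h2⟩
    exact bijOn_defDifferential.injOn h1 (Submodule.zero_mem _)
      ((LinearMap.mem_ker.mp h2).trans (_root_.map_zero _).symm)
  by_cases h1 : j = -1
  · subst h1
    rw [neg_add_cancel]
    apply SetLike.coe_injective
    rw [Submodule.map_coe, bijOn_defDifferential.image_eq]
    -- Everything in degree `-1` is a cycle, since degree `-2` is zero.
    refine congrArg _ (inf_eq_left.mpr fun φ hφ => ?_)
    have h := defDifferential_mem hφ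
    rwa [hbot (-1 + -1) (by norm_num) (by norm_num)] at h
  · rw [hbot j h0 h1, bot_inf_eq, eq_comm, eq_bot_iff]
    rintro _ ⟨φ, hφ, rfl⟩
    have h := defDifferential_mem hφ
    rwa [show -1 + (j + 1) = j by ring, hbot j h0 h1] at h

end Deformation

end PreLieDef

/-- The deformation complex of the projection `PL → Com` is acyclic; it is concentrated in degrees
`0` and `-1`, where it is one-dimensional and the differential is an isomorphism. -/
theorem mainTheorem6 (k : Type*) [Field k] [CharZero k] :
    PreLieDef.DeformationAcyclic (PreLieDef.projPLCom k) ∧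
      (∀ j : ℤ, j ≠ 0 → j ≠ -1 → PreLieDef.defDegree (PreLieDef.projPLCom k) j = ⊥) ∧
      Module.finrank k (PreLieDef.defDegree (PreLieDef.projPLCom k) 0) = 1 ∧
      Set.BijOn (PreLieDef.defDifferential (PreLieDef.projPLCom k) 0)
        (PreLieDef.defDegree (PreLieDef.projPLCom k) 0)
        (PreLieDef.defDegree (PreLieDef.projPLCom k) (-1)) :=
  ⟨PreLieDef.deformationAcyclic_projPLCom, PreLieDef.degree_eq_bot,
    PreLieDef.finrank_degree_zero, PreLieDef.bijOn_defDifferential⟩
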